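/- Let $L\ge 2$ and $n\ge 1$ be integers. The Hamming graph $K_L^n$ has vertex set $\{0,\dots,L-1\}^n$, two vertices being adjacent iff they differ in exactly one coordinate. For a property $\mathcal P$, a $\mathcal P$-conditional edge-cut of a graph $G$ is a set $F\subseteq E(G)$ such that $G-F$ is disconnected and every component of $G-F$ satisfies $\mathcal P$; the $\mathcal P$-conditional edge-connectivity $\lambda(\mathcal P,G)$ is the minimum size of such a cut. Write $[X,\overline X]$ for the set of edges with exactly one end in $X$, where $\overline X=V(G)\setminus X$. (1) For every integer $0\le t\le n-1$, the following quantities for $G=K_L^n$ all exist and are equal to $(L-1)(n-t)L^t$: - $\xi_{L^t}(G)$, where $\xi_m(G)$ is the minimum of $|[X,\overline X]|$ over all $X\subset V(G)$ with $|X|=m\le\lfloor |V(G)|/2\rfloor$ and both $G[X]$ and $G[\overline X]$ connected; - the $L^t$-extra edge-connectivity ($\mathcal P$: the component has at least $L^t$ vertices); - the $t$-embedded edge-connectivity ($\mathcal P$: every vertex of the component lies in a $t$-dimensional sub-layer of $K_L^n$ all of whose vertices and edges belong to the component), where a $t$-dimensional sub-layer is the subgraph induced by the vertices with prescribed values in $n-t$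 of the coordinates; the value is the same if these must be the $n-t$ leading coordinates; - the $(L-1)t$-super edge-connectivity ($\mathcal P$: the component has minimum degree at least $(L-1)t$); - the $(L-1)t$-average edge-connectivity ($\mathcal P$: the component has average degree at least $(L-1)t$); - the $L^t$-th isoperimetric edge-connectivity $\min\{|[U,\overline U]| : U\subset V(G),\ |U|\ge L^t,\ |\overline U|\ge L^t\}$. (2) Put $(g,s)=(1,2)$ if $L=2$, $(g,s)=(1,1)$ if $L=3$, and $(g,s)=(3,0)$ if $L\ge 4$, and suppose that $gL^s\le\lfloor L^n/2\rfloor$ (that is, $n\ge3$ if $L=2$; $n\ge 2$ if $L\in\{3,4,5\}$; $n\ge 1$ if $L\ge 6$). Then the cyclic edge-connectivity of $K_L^n$ exists and is equal to $$g\,[(L-1)(n-s)-(g-1)]\,L^s .$$ This holds both when the cyclic edge-connectivity is the minimum size of an edge set $F$ such that $K_L^n-F$ is disconnected and each of its components contains a cycle, and when it is the minimum size of an $F$ such that $K_L^n-F$ is disconnected and at least two of its components contain a cycle. -/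

import Mathlib

/-- The `L`-ary `n`-dimensional Hamming graph `K_L^n`: the vertices are the strings of length `n`
over `{0, …, L - 1}`, two of them being adjacent iff they differ in exactly one coordinate. -/
def hammingGraph (L n : ℕ) : SimpleGraph (Fin n → Fin L) where
  Adj u v := ∃! i, u i ≠ v i
  symm := ⟨fun u v ⟨i, hi, h⟩ => ⟨i, fun e => hi e.symm, fun j hj => h j fun e => hj e.symm⟩⟩
  loopless := ⟨fun _ ⟨_, hi, _⟩ => hi rfl⟩

section Connectivities

/-- The set `[U, Uᶜ]` of edges of `G` with one end in `U` and the other end outside `U`. -/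
def edgesBetween {V : Type*} (G : SimpleGraph V) (U : Set V) : Set (Sym2 V) :=
  {e | e ∈ G.edgeSet ∧ ∃ u ∈ U, ∃ v ∉ U, e = s(u, v)}

/-- A property of a connected component of a graph on the vertex set `V`. -/
abbrev ComponentProperty (V : Type*) := (H : SimpleGraph V) → H.ConnectedComponent → Prop

/-- `F` is a `P`-conditional edge-cut of `G`: a set of edges of `G` such that `G - F` is
disconnected and every component of `G - F` satisfies `P`. -/
def IsConditionalEdgeCut {V : Type*} (G : SimpleGraph V) (P : ComponentProperty V)
    (F : Finset (Sym2 V)) : Prop :=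
  (F : Set (Sym2 V)) ⊆ G.edgeSet ∧ ¬ (G.deleteEdges (F : Set (Sym2 V))).Connected ∧
    ∀ c : (G.deleteEdges (F : Set (Sym2 V))).ConnectedComponent, P _ c

/-- The `P`-conditional edge-connectivity of `G` exists and equals `k`: the minimum
cardinality of a `P`-conditional edge-cut is `k`. -/
def IsConditionalEdgeConnectivity {V : Type*} (G : SimpleGraph V) (P : ComponentProperty V)
    (k : ℕ) : Prop :=
  IsLeast {m | ∃ F : Finset (Sym2 V), IsConditionalEdgeCut G P F ∧ F.card = m} k

/-- The component has at least `h` vertices (`h`-extra edge-connectivity). -/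
def HasAtLeastVertices {V : Type*} (h : ℕ) : ComponentProperty V :=
  fun _ c => h ≤ c.supp.ncard

/-- The component contains a cycle. -/
def ContainsCycle {V : Type*} : ComponentProperty V :=
  fun _ c => ∃ (v : c) (p : c.toSimpleGraph.Walk v v), p.IsCycle

open Classical in
/-- The component has minimum degree at least `k` (`k`-super edge-connectivity). -/
def HasMinDegreeAtLeast {V : Type*} [Fintype V] (k : ℕ) : ComponentProperty V :=
  fun _ c => ∀ v : c, k ≤ c.toSimpleGraph.degree v

open Classical in
/-- The component has average degree at least `k` (`k`-average edge-connectivity). -/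
def HasAverageDegreeAtLeast {V : Type*} [Fintype V] (k : ℕ) : ComponentProperty V :=
  fun _ c => (k : ℚ) ≤ (∑ v : c, (c.toSimpleGraph.degree v : ℚ)) / (Fintype.card c : ℚ)

/-- Every vertex of the component lies in one of the given subnetworks of `G` (each of them given
by its vertex set `S ∈ 𝒮` and consisting of all edges of `G` inside `S`) that is contained
in the component, none of its edges having been removed. -/
def CoveredBySubnetworks {V : Type*} (G : SimpleGraph V) (𝒮 : Set (Set V)) :
    ComponentProperty V :=
  fun H c => ∀ v ∈ c.supp, ∃ S ∈ 𝒮, v ∈ S ∧ S ⊆ c.supp ∧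
    ∀ x ∈ S, ∀ y ∈ S, G.Adj x y → H.Adj x y

/-- The vertex sets of the `t`-dimensional sub-layers of `K_L^n`: `t` coordinates are free and
the `n - t` other ones are fixed. -/
def subLayers (L n t : ℕ) : Set (Set (Fin n → Fin L)) :=
  {S | ∃ I : Finset (Fin n), I.card = t ∧ ∃ z : Fin n → Fin L, S = {v | ∀ i ∉ I, v i = z i}}

/-- The `t`-dimensional sub-layers `z_n ⋯ z_{t+1} X_t ⋯ X_1` of `K_L^n`, in which the `n - t`
leading coordinates are fixed (the coordinate `x_{i+1}` of a string `x_n ⋯ x_1` has index `i`). -/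
def leadingSubLayers (L n t : ℕ) : Set (Set (Fin n → Fin L)) :=
  {S | ∃ z : Fin n → Fin L, S = {v | ∀ i : Fin n, t ≤ (i : ℕ) → v i = z i}}

/-- `F` is a cyclic edge-cut of `G`: a set of edges such that `G - F` is disconnected and
at least two components of `G - F` contain a cycle. -/
def IsCyclicEdgeCut {V : Type*} (G : SimpleGraph V) (F : Finset (Sym2 V)) : Prop :=
  (F : Set (Sym2 V)) ⊆ G.edgeSet ∧ ¬ (G.deleteEdges (F : Set (Sym2 V))).Connected ∧
    ∃ c d : (G.deleteEdges (F : Set (Sym2 V))).ConnectedComponent,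
      c ≠ d ∧ ContainsCycle _ c ∧ ContainsCycle _ d

/-- The cyclic edge-connectivity of `G` exists and equals `k`. -/
def IsCyclicEdgeConnectivity {V : Type*} (G : SimpleGraph V) (k : ℕ) : Prop :=
  IsLeast {m | ∃ F : Finset (Sym2 V), IsCyclicEdgeCut G F ∧ F.card = m} k

/-- The `h`-th isoperimetric edge-connectivity `γ_h(G)` exists and equals `k`. -/
def IsIsoperimetricEdgeConnectivity {V : Type*} (G : SimpleGraph V) (h k : ℕ) : Prop :=
  IsLeast {m | ∃ U : Set V, h ≤ U.ncard ∧ h ≤ Uᶜ.ncard ∧ (edgesBetween G U).ncard = m} k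

/-- `ξ_m(G)` exists and equals `k`: it is the minimum of `|[X, Xᶜ]|` over the sets `X` of
`m ≤ ⌊|V(G)| / 2⌋` vertices such that `G[X]` and `G[Xᶜ]` are both connected. -/
def IsXi {V : Type*} (G : SimpleGraph V) (m k : ℕ) : Prop :=
  IsLeast {j | ∃ X : Set V, X.ncard = m ∧ m ≤ Nat.card V / 2 ∧ (G.induce X).Connected ∧
    (G.induce Xᶜ).Connected ∧ (edgesBetween G X).ncard = j} k

end Connectivities

/-! Every quantity is squeezed between one isoperimetric inequality and one cut. Being covered by
leading sub-layers implies being covered by sub-layers, hence minimum degree at least `(L - 1) t`,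
hence average degree at least `(L - 1) t`, hence at least `L ^ t` vertices. A cut with two
components of at least `L ^ t` vertices contains the edge boundary of one of them, and both that
component and its complement have at least `L ^ t` vertices. It therefore suffices to bound such
boundaries below by `(L - 1)(n - t) L ^ t`; the boundary of a standard sub-layer attains the bound
and satisfies the strongest property.

The inequality combines two estimates. For a uniform point of `U`, Han's entropy inequality bounds
the sum of the logarithms of the line counts by `|U| log |U|` (`sum_log_lineCount_le`). Replacing
the logarithm by its chord on `[1, L]` shows that the degrees inside `U` sum to at most `(L - 1)|U|
log_L |U|`. This gives the last implication of the chain, and also a boundary of at least `(L -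
1)|U|(n - log_L |U|)`, which is concave in `|U|` and so is controlled on `[L ^ t, L ^ (n - 1)]` by
the endpoints. Between `L ^ (n - 1)` and `L ^ n - L ^ (n - 1)` the Poincaré inequality
(`card_mul_card_compl_le`) takes over; larger sets are handled by complementation.

For cycles, a component needs 4 vertices if `L = 2` (the hypercube is bipartite) and 3 otherwise.
These numbers are `2 ^ 2` and `3 ^ 1` for `L = 2, 3`, so the same bound applies; for `L ≥ 4` a
degree count treats sets of 3 to `L` points, and three collinear points are extremal. -/

open Finset in
/-- The number of points of `U` on the line through `x` in the direction of the coordinate `i`. -/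
def lineCount {n : ℕ} {α : Type*} [Fintype α] [DecidableEq α] (U : Finset (Fin n → α))
    (i : Fin n) (x : Fin n → α) : ℕ :=
  #{a | Function.update x i a ∈ U}

open Finset in
/-- The points of `U` with leading coordinate `a`, that coordinate being dropped. -/
def slice {n : ℕ} {α : Type*} [Fintype α] [DecidableEq α] (U : Finset (Fin (n + 1) → α))
    (a : α) : Finset (Fin n → α) :=
  {y | (Fin.cons a y : Fin (n + 1) → α) ∈ U}

open Finset in
/-- The number of points of `U` that project to `y` when the leading coordinate is dropped. -/
def fiberCount {n : ℕ} {α : Type*} [Fintype α] [DecidableEq α] (U : Finset (Fin (n + 1) → α))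
    (y : Fin n → α) : ℕ :=
  #{a | (Fin.cons a y : Fin (n + 1) → α) ∈ U}

/-! ### Entropy and Poincaré inequalities, by slicing along the leading coordinate -/

section Slices

variable {n : ℕ} {α : Type*} [Fintype α] [DecidableEq α]

theorem mem_slice {U : Finset (Fin (n + 1) → α)} {a : α} {y : Fin n → α} :
    y ∈ slice U a ↔ (Fin.cons a y : Fin (n + 1) → α) ∈ U := by
  simp [slice]

theorem sum_eq_sum_slice {M : Type*} [AddCommMonoid M] (U : Finset (Fin (n + 1) → α))
    (g : (Fin (n + 1) → α) → M) :
    ∑ x ∈ U, g x = ∑ a, ∑ y ∈ slice U a, g (Fin.cons a y) := by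
  simp only [slice, Finset.sum_filter]
  rw [← Fintype.sum_prod_type', ← Fintype.sum_ite_mem]
  exact (Equiv.sum_comp (Fin.consEquiv fun _ => α) fun x => if x ∈ U then g x else 0).symm

theorem card_eq_sum_card_slice (U : Finset (Fin (n + 1) → α)) :
    U.card = ∑ a, (slice U a).card := by
  simp only [Finset.card_eq_sum_ones, sum_eq_sum_slice U fun _ => 1]

theorem card_eq_sum_fiberCount (U : Finset (Fin (n + 1) → α)) :
    U.card = ∑ y, fiberCount U y := by
  rw [card_eq_sum_card_slice]
  simp only [slice, fiberCount, Finset.card_filter]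
  exact Finset.sum_comm

theorem lineCount_zero_cons (U : Finset (Fin (n + 1) → α)) (a : α) (y : Fin n → α) :
    lineCount U 0 (Fin.cons a y) = fiberCount U y := by
  simp [lineCount, fiberCount, Fin.update_cons_zero]

theorem lineCount_succ_cons (U : Finset (Fin (n + 1) → α)) (i : Fin n) (a : α) (y : Fin n → α) :
    lineCount U i.succ (Fin.cons a y) = lineCount (slice U a) i y := by
  simp [lineCount, mem_slice, Fin.cons_update]

theorem lineCount_pos {U : Finset (Fin n → α)} {i : Fin n} {x : Fin n → α} (hx : x ∈ U) :
    0 < lineCount U i x :=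
  Finset.card_pos.2 ⟨x i, by simpa using hx⟩

theorem lineCount_le (U : Finset (Fin n → α)) (i : Fin n) (x : Fin n → α) :
    lineCount U i x ≤ Fintype.card α :=
  Finset.card_le_univ _

theorem sum_sum_lineCount_succ {M : Type*} [AddCommMonoid M] (φ : ℕ → M)
    (U : Finset (Fin (n + 1) → α)) :
    ∑ x ∈ U, ∑ i, φ (lineCount U i x) =
      ∑ a, ∑ y ∈ slice U a, φ (fiberCount U y) +
        ∑ a, ∑ y ∈ slice U a, ∑ i, φ (lineCount (slice U a) i y) := by
  rw [sum_eq_sum_slice, ← Finset.sum_add_distrib]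
  refine Finset.sum_congr rfl fun a _ => ?_
  rw [← Finset.sum_add_distrib]
  refine Finset.sum_congr rfl fun y _ => ?_
  rw [Fin.sum_univ_succ, lineCount_zero_cons]
  simp only [lineCount_succ_cons]

/-- Conditioning does not increase entropy: for a uniform point `(a, y)` of `U`, the left side is
`|U| H(a | y)` and the right side `|U| H(a)`. The proof is Gibbs' inequality, `log x ≤ x - 1` at `x
= fiber * slice / |U|`. -/
theorem sum_log_fiberCount_le (U : Finset (Fin (n + 1) → α)) :
    ∑ a, ∑ y ∈ slice U a, Real.log (fiberCount U y) ≤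
      U.card * Real.log U.card - ∑ a, (slice U a).card * Real.log (slice U a).card := by
  rcases U.eq_empty_or_nonempty with rfl | hU
  · simp [slice]
  have hM : (0 : ℝ) < U.card := by exact_mod_cast hU.card_pos
  have hcard : (U.card : ℝ) = ∑ a, ((slice U a).card : ℝ) := by
    exact_mod_cast card_eq_sum_card_slice U
  have hfib : (U.card : ℝ) = ∑ y, (fiberCount U y : ℝ) := by
    exact_mod_cast card_eq_sum_fiberCount U
  have hterm : ∀ a, ∀ y ∈ slice U a, Real.log (fiberCount U y) ≤
      Real.log U.card - Real.log (slice U a).card +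
        (fiberCount U y * (slice U a).card / U.card - 1) := by
    intro a y hy
    have h1 : (0 : ℝ) < fiberCount U y := by
      exact_mod_cast Finset.card_pos.2 ⟨a, by simpa using mem_slice.1 hy⟩
    have h2 : (0 : ℝ) < (slice U a).card := by exact_mod_cast Finset.card_pos.2 ⟨y, hy⟩
    have h3 := Real.log_le_sub_one_of_pos (div_pos (mul_pos h1 h2) hM)
    rw [Real.log_div (by positivity) (by positivity), Real.log_mul (by positivity) (by positivity)]
      at h3
    linarith
  have hbound : ∀ a, ∑ y ∈ slice U a, (fiberCount U y : ℝ) ≤ U.card := fun a => by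
    rw [hfib]
    exact Finset.sum_le_univ_sum_of_nonneg fun _ => Nat.cast_nonneg _
  calc ∑ a, ∑ y ∈ slice U a, Real.log (fiberCount U y)
      ≤ ∑ a, ∑ y ∈ slice U a, (Real.log U.card - Real.log (slice U a).card +
        (fiberCount U y * (slice U a).card / U.card - 1)) :=
        Finset.sum_le_sum fun a _ => Finset.sum_le_sum (hterm a)
    _ = ∑ a, (((slice U a).card : ℝ) * Real.log U.card -
          (slice U a).card * Real.log (slice U a).card +
          ((∑ y ∈ slice U a, (fiberCount U y : ℝ)) * (slice U a).card / U.card -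
            (slice U a).card)) := by
        refine Finset.sum_congr rfl fun a _ => ?_
        rw [Finset.sum_add_distrib, Finset.sum_sub_distrib, Finset.sum_sub_distrib,
          ← Finset.sum_div, ← Finset.sum_mul]
        simp
    _ ≤ ∑ a, (((slice U a).card : ℝ) * Real.log U.card -
          (slice U a).card * Real.log (slice U a).card) := by
        refine Finset.sum_le_sum fun a _ => ?_
        have : (∑ y ∈ slice U a, (fiberCount U y : ℝ)) * (slice U a).card / U.card ≤
            (slice U a).card := by
          rw [div_le_iff₀ hM, mul_comm]
          exact mul_le_mul_of_nonneg_left (hbound a) (Nat.cast_nonneg _)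
        linarith
    _ = _ := by rw [Finset.sum_sub_distrib, ← Finset.sum_mul, ← hcard]

/-- Han's inequality for the uniform distribution on a finite set `U` of strings. -/
theorem sum_log_lineCount_le : ∀ {n : ℕ} (U : Finset (Fin n → α)),
    ∑ x ∈ U, ∑ i, Real.log (lineCount U i x) ≤ U.card * Real.log U.card
  | 0, U => by simpa using mul_nonneg (Nat.cast_nonneg _) (Real.log_natCast_nonneg _)
  | n + 1, U => by
    rw [sum_sum_lineCount_succ (fun k : ℕ => Real.log k)]
    -- The terms `∑ s log s` over the slice sizes `s` cancel between the leading coordinate and the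
    -- induction hypothesis.
    have h1 := sum_log_fiberCount_le U
    have h2 := Finset.sum_le_sum (s := Finset.univ)
      fun a _ => sum_log_lineCount_le (slice U a)
    linarith

/-- Tensorization of the Poincaré inequality. Given `(a, x)` in `U` and `(b, y)` outside, pass
through `(b, x)`: if it is in `U`, the pair `(b, x), (b, y)` is separated within a slice, otherwise
`(a, x), (b, x)` is separated within a fibre. Sum over all `a, x, b, y`. -/
theorem card_slice_mul_add_card_fiber_mul_ge (U : Finset (Fin (n + 1) → α)) :
    (U.card : ℝ) * (Fintype.card α * Fintype.card α ^ n - U.card) ≤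
      Fintype.card α * ∑ a, ((slice U a).card : ℝ) * (Fintype.card α ^ n - (slice U a).card) +
      Fintype.card α ^ n * ∑ y, (fiberCount U y : ℝ) * (Fintype.card α - fiberCount U y) := by
  classical
  set L : ℝ := (Fintype.card α : ℝ) with hLdef
  set χ : α → (Fin n → α) → ℝ := fun a y => if (Fin.cons a y : Fin (n + 1) → α) ∈ U then 1 else 0
    with hχ
  have hs : ∀ a, ((slice U a).card : ℝ) = ∑ y, χ a y := fun a => by simp [hχ, slice]
  have hf : ∀ y, (fiberCount U y : ℝ) = ∑ a, χ a y := fun y => by simp [hχ, fiberCount]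
  have hU : (U.card : ℝ) = ∑ a, ∑ y, χ a y := by
    rw [card_eq_sum_card_slice]
    push_cast
    simp [hs]
  have hN : (∑ _y : Fin n → α, (1 : ℝ)) = L ^ n := by simp [hLdef]
  have hL : (∑ _a : α, (1 : ℝ)) = L := by simp [hLdef]
  have hcs : ∀ a, (L ^ n - (slice U a).card : ℝ) = ∑ y, (1 - χ a y) := fun a => by
    rw [Finset.sum_sub_distrib, hN, hs]
  have hcf : ∀ y, (L - fiberCount U y : ℝ) = ∑ a, (1 - χ a y) := fun y => by
    rw [Finset.sum_sub_distrib, hL, hf]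
  have hcU : L * L ^ n - U.card = ∑ a, ∑ y, (1 - χ a y) := by
    simp only [Finset.sum_sub_distrib, hN, ← hU]
    simp [hLdef]
  have key : ∀ a x b y, χ a x * (1 - χ b y) ≤ χ b x * (1 - χ b y) + χ a x * (1 - χ b x) := by
    intro a x b y
    simp only [hχ]
    split_ifs <;> norm_num
  have h1 : (U.card : ℝ) * (L * L ^ n - U.card) =
      ∑ a, ∑ x, ∑ b, ∑ y, χ a x * (1 - χ b y) := by
    rw [hcU, hU]
    simp only [Finset.sum_mul]
    simp only [Finset.mul_sum]
  have h2 : L * ∑ a, ((slice U a).card : ℝ) * (L ^ n - (slice U a).card) =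
      ∑ _a : α, ∑ x, ∑ b, ∑ y, χ b x * (1 - χ b y) := by
    simp only [hcs]
    rw [Finset.sum_const, nsmul_eq_mul, Finset.card_univ, Finset.sum_comm]
    simp only [hs, Finset.sum_mul, Finset.mul_sum, hLdef]
    refine Finset.sum_congr rfl fun b _ => ?_
    exact Finset.sum_comm
  have h3 : L ^ n * ∑ y, (fiberCount U y : ℝ) * (L - fiberCount U y) =
      ∑ a, ∑ x, ∑ b, ∑ _y : Fin n → α, χ a x * (1 - χ b x) := by
    have hc : ∀ c : ℝ, ∑ _y : Fin n → α, c = L ^ n * c := fun c => by simp [hLdef]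
    simp only [hc, ← Finset.mul_sum, hcf]
    simp only [hf]
    rw [Finset.sum_comm]
    simp only [Finset.sum_mul]
  rw [h1, h2, h3]
  simp only [← Finset.sum_add_distrib]
  exact Finset.sum_le_sum fun a _ => Finset.sum_le_sum fun x _ => Finset.sum_le_sum fun b _ =>
    Finset.sum_le_sum fun y _ => key a x b y

/-- The Poincaré inequality for the edge boundary of a set of strings. -/
theorem card_mul_card_compl_le : ∀ {n : ℕ} (U : Finset (Fin n → α)),
    (Fintype.card α : ℝ) * (U.card * (Fintype.card α ^ n - U.card)) ≤
      Fintype.card α ^ n * ∑ x ∈ U, ∑ i, ((Fintype.card α : ℝ) - lineCount U i x)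
  | 0, U => by
    have h : U.card ≤ 1 := by simpa using Finset.card_le_univ U
    interval_cases U.card <;> simp
  | n + 1, U => by
    rw [sum_sum_lineCount_succ (fun k : ℕ => (Fintype.card α : ℝ) - k)]
    have h1 := card_slice_mul_add_card_fiber_mul_ge U
    have h2 := Finset.sum_le_sum (s := Finset.univ)
      fun a _ => card_mul_card_compl_le (slice U a)
    have h3 : ∑ a, ∑ y ∈ slice U a, ((Fintype.card α : ℝ) - fiberCount U y) =
        ∑ y, (fiberCount U y : ℝ) * (Fintype.card α - fiberCount U y) := by
      simp only [slice, Finset.sum_filter]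
      rw [Finset.sum_comm]
      refine Finset.sum_congr rfl fun y _ => ?_
      rw [← Finset.sum_filter, Finset.sum_const, nsmul_eq_mul, fiberCount]
    rw [h3]
    rw [← Finset.mul_sum, ← Finset.mul_sum] at h2
    have hL : (0 : ℝ) ≤ Fintype.card α := Nat.cast_nonneg _
    have h4 := mul_le_mul_of_nonneg_left h1 hL
    have h5 := mul_le_mul_of_nonneg_left h2 hL
    rw [pow_succ]
    linarith

end Slices

/-! ### Edge-isoperimetric inequalities -/

section Isoperimetry

variable {n : ℕ} {α : Type*} [Fintype α] [DecidableEq α]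

/-- The number of edges of the Hamming graph that leave `U`. -/
def boundaryCount (U : Finset (Fin n → α)) : ℕ :=
  ∑ x ∈ U, ∑ i, (Fintype.card α - lineCount U i x)

theorem cast_boundaryCount (U : Finset (Fin n → α)) :
    (boundaryCount U : ℝ) = ∑ x ∈ U, ∑ i, ((Fintype.card α : ℝ) - lineCount U i x) := by
  simp only [boundaryCount, Nat.cast_sum, Nat.cast_sub (lineCount_le _ _ _)]

theorem sum_lineCount_add_boundaryCount (U : Finset (Fin n → α)) :
    ∑ x ∈ U, ∑ i, (lineCount U i x - 1) + boundaryCount U =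
      U.card * (n * (Fintype.card α - 1)) := by
  rw [boundaryCount, ← Finset.sum_add_distrib, ← smul_eq_mul, ← Finset.sum_const]
  refine Finset.sum_congr rfl fun x hx => ?_
  rw [← Finset.sum_add_distrib]
  have : ∀ i, (lineCount U i x - 1) + (Fintype.card α - lineCount U i x) =
      Fintype.card α - 1 := fun i => by
    have h1 := lineCount_pos (i := i) hx
    have h2 := lineCount_le U i x
    omega
  simp [this]

/-- The chord of the logarithm between `1` and `L` lies below its graph. -/
theorem sub_one_mul_log_le {k L : ℕ} (hk : 1 ≤ k) (hkL : k ≤ L) :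
    ((k : ℝ) - 1) * Real.log L ≤ (L - 1) * Real.log k := by
  have hk' : (1 : ℝ) ≤ k := by exact_mod_cast hk
  have hkL' : (k : ℝ) ≤ L := by exact_mod_cast hkL
  rcases hk'.eq_or_lt with h | h
  · simp [← h]
  have hL : (0 : ℝ) < L - 1 := by linarith
  have h1 := strictConcaveOn_log_Ioi.concaveOn.2 (Set.mem_Ioi.2 one_pos)
    (Set.mem_Ioi.2 (show (0 : ℝ) < L by linarith))
    (div_nonneg (sub_nonneg.2 hkL') hL.le) (div_nonneg (sub_nonneg.2 hk') hL.le)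
    (by field_simp; ring)
  have h2 : ((L - k) / (L - 1) : ℝ) • (1 : ℝ) + ((k - 1) / (L - 1) : ℝ) • (L : ℝ) = k := by
    simp only [smul_eq_mul]
    field_simp
    ring
  rw [h2] at h1
  simp only [smul_eq_mul, Real.log_one, mul_zero, zero_add] at h1
  rw [div_mul_eq_mul_div, div_le_iff₀ hL] at h1
  linarith

/-- Twice the number of edges inside `U` is at most `(L - 1) |U| log_L |U|`. -/
theorem sum_lineCount_sub_one_mul_log_le (U : Finset (Fin n → α)) :
    ((∑ x ∈ U, ∑ i, (lineCount U i x - 1) : ℕ) : ℝ) * Real.log (Fintype.card α) ≤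
      ((Fintype.card α : ℝ) - 1) * (U.card * Real.log U.card) := by
  rcases U.eq_empty_or_nonempty with rfl | ⟨z, hz⟩
  · simp
  -- For `n = 0` the alphabet may be empty and `L - 1` negative, so this case is separate.
  rcases n.eq_zero_or_pos with rfl | hn
  · have h : U.card ≤ 1 := by simpa using Finset.card_le_univ U
    interval_cases U.card <;> simp
  have hα : (1 : ℝ) ≤ Fintype.card α := by
    exact_mod_cast Fintype.card_pos_iff.2 ⟨z ⟨0, hn⟩⟩
  refine le_trans ?_ (mul_le_mul_of_nonneg_left (sum_log_lineCount_le U) (by linarith))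
  push_cast
  simp only [Finset.sum_mul, Finset.mul_sum]
  refine Finset.sum_le_sum fun x hx => Finset.sum_le_sum fun i _ => ?_
  have h := lineCount_pos (i := i) hx
  rw [Nat.cast_sub h, Nat.cast_one]
  exact sub_one_mul_log_le h (lineCount_le U i x)

/-- A set of strings whose induced subgraph has average degree at least `(L - 1) t` has at least
`L ^ t` elements. -/
theorem pow_le_card_of_mul_le_sum {t : ℕ} {U : Finset (Fin n → α)} (hU : U.Nonempty)
    (hα : 2 ≤ Fintype.card α)
    (h : U.card * ((Fintype.card α - 1) * t) ≤ ∑ x ∈ U, ∑ i, (lineCount U i x - 1)) :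
    Fintype.card α ^ t ≤ U.card := by
  have hL : (2 : ℝ) ≤ Fintype.card α := by exact_mod_cast hα
  have hlog : 0 < Real.log (Fintype.card α) := Real.log_pos (by linarith)
  have hM : (0 : ℝ) < U.card := by exact_mod_cast hU.card_pos
  have h1 := sum_lineCount_sub_one_mul_log_le U
  have h2 : (U.card : ℝ) * (((Fintype.card α : ℝ) - 1) * t) ≤
      ((∑ x ∈ U, ∑ i, (lineCount U i x - 1) : ℕ) : ℝ) := by
    rw [← Nat.cast_one, ← Nat.cast_sub (by omega)]
    exact_mod_cast h
  have h3 := (mul_le_mul_of_nonneg_right h2 hlog.le).trans h1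
  have h4 : (t : ℝ) * Real.log (Fintype.card α) ≤ Real.log U.card := by
    refine le_of_mul_le_mul_left ?_ (mul_pos hM (show (0 : ℝ) < Fintype.card α - 1 by linarith))
    linarith
  rw [← Real.log_pow] at h4
  exact_mod_cast (Real.log_le_log_iff (by positivity) hM).1 h4

theorem mul_pow_le_boundaryCount_of_le {t : ℕ} (ht : t < n) (hα : 2 ≤ Fintype.card α)
    {U : Finset (Fin n → α)} (h1 : Fintype.card α ^ t ≤ U.card)
    (h2 : U.card ≤ Fintype.card α ^ (n - 1)) :
    (Fintype.card α - 1) * (n - t) * Fintype.card α ^ t ≤ boundaryCount U := by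
  obtain ⟨k, rfl⟩ : ∃ k, n = k + 1 := ⟨n - 1, by omega⟩
  have htk : t ≤ k := by omega
  set L := Fintype.card α with hLdef
  have hL : (2 : ℝ) ≤ L := by exact_mod_cast hα
  have hlog : 0 < Real.log L := Real.log_pos (by linarith)
  -- `f x = x (n - log_L x) log L` with `n = k + 1`: up to the factor `(L - 1) / log L`, the entropy
  -- lower bound for the boundary.
  set f : ℝ → ℝ := fun x => (k + 1) * Real.log L * x + Real.negMulLog x with hf
  have hconc : ConcaveOn ℝ (Set.Ici 0) f :=
    ((LinearMap.mulLeft ℝ (((k : ℝ) + 1) * Real.log L)).concaveOn (convex_Ici 0)).add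
      Real.concaveOn_negMulLog
  have hpow : ∀ j : ℕ, f ((L : ℝ) ^ j) = ((k + 1 - j) * L ^ j) * Real.log L := fun j => by
    simp only [hf, Real.negMulLog, Real.log_pow]
    ring
  have hmin := hconc.min_le_of_mem_Icc (x := (L : ℝ) ^ t) (y := (L : ℝ) ^ k) (z := U.card)
    (by simp only [Set.mem_Ici]; positivity) (by simp only [Set.mem_Ici]; positivity)
    ⟨by exact_mod_cast h1, by exact_mod_cast h2⟩
  -- The endpoint `L ^ t` gives the smaller value: with `d = k - t` this is `d + 1 ≤ L ^ d`.
  have hend : (k + 1 - t) * L ^ t ≤ L ^ k := by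
    obtain ⟨d, rfl⟩ := Nat.exists_eq_add_of_le htk
    rw [pow_add, mul_comm]
    refine Nat.mul_le_mul_left _ ?_
    have : d < L ^ d := Nat.lt_pow_self hα
    omega
  have hsub : ((k + 1 - t : ℕ) : ℝ) = k + 1 - t := by
    rw [Nat.cast_sub (by omega)]
    push_cast
    ring
  have hend' : ((k : ℝ) + 1 - t) * L ^ t ≤ L ^ k := by
    rw [← hsub]
    exact_mod_cast hend
  have hval : (((k : ℝ) + 1 - t) * L ^ t) * Real.log L ≤ f U.card := by
    refine le_trans (le_min (hpow t).ge ?_) hmin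
    rw [hpow]
    refine mul_le_mul_of_nonneg_right ?_ hlog.le
    linarith
  have hent := sum_lineCount_sub_one_mul_log_le U
  have hsum : ((∑ x ∈ U, ∑ i, (lineCount U i x - 1) : ℕ) : ℝ) + boundaryCount U =
      U.card * ((k + 1) * (L - 1)) := by
    have := sum_lineCount_add_boundaryCount U
    rw [← Nat.cast_add, this]
    push_cast [Nat.cast_sub (show 1 ≤ Fintype.card α by omega)]
    rfl
  have hfin : ((L : ℝ) - 1) * (((k : ℝ) + 1 - t) * L ^ t) * Real.log L ≤
      boundaryCount U * Real.log L := by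
    have h3 := mul_le_mul_of_nonneg_left hval (show (0 : ℝ) ≤ L - 1 by linarith)
    have h4 : (boundaryCount U : ℝ) = U.card * ((k + 1) * (L - 1)) -
      ((∑ x ∈ U, ∑ i, (lineCount U i x - 1) : ℕ) : ℝ) := by linarith
    rw [h4, sub_mul]
    simp only [hf, Real.negMulLog] at h3
    linarith
  have := le_of_mul_le_mul_right hfin hlog
  rw [← hsub, ← mul_assoc, ← Nat.cast_one, ← Nat.cast_sub (by omega)] at this
  exact_mod_cast this

/-- With `N = L ^ n` and `m = |U|`, Poincaré gives a boundary of at least `L m (N - m) / N`. On this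
range `m (N - m)` is least at the endpoints, where the bound is the claimed value. -/
theorem mul_pow_le_boundaryCount_of_mem_Icc (hn : 0 < n) (hα : 2 ≤ Fintype.card α)
    {U : Finset (Fin n → α)} (h1 : Fintype.card α ^ (n - 1) ≤ U.card)
    (h2 : U.card + Fintype.card α ^ (n - 1) ≤ Fintype.card α ^ n) :
    (Fintype.card α - 1) * Fintype.card α ^ (n - 1) ≤ boundaryCount U := by
  obtain ⟨k, rfl⟩ : ∃ k, n = k + 1 := ⟨n - 1, by omega⟩
  have h := card_mul_card_compl_le U
  rw [← cast_boundaryCount] at h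
  simp only [Nat.add_sub_cancel] at *
  set L := Fintype.card α with hLdef
  have hL : (2 : ℝ) ≤ L := by exact_mod_cast hα
  have h1' : (L : ℝ) ^ k ≤ U.card := by exact_mod_cast h1
  have h2' : (U.card : ℝ) + L ^ k ≤ L ^ (k + 1) := by exact_mod_cast h2
  have hp : (0 : ℝ) < L ^ k := by positivity
  have h3 : (L : ℝ) ^ k * (L ^ (k + 1) - L ^ k) ≤ U.card * (L ^ (k + 1) - U.card) := by
    nlinarith [mul_nonneg (sub_nonneg.2 h1') (sub_nonneg.2 h2')]
  have h4 : ((L : ℝ) - 1) * L ^ k ≤ boundaryCount U := by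
    have h5 := (mul_le_mul_of_nonneg_left h3 (show (0 : ℝ) ≤ L by linarith)).trans h
    have hp' : (0 : ℝ) < L ^ (k + 1) := by positivity
    refine le_of_mul_le_mul_left ?_ hp'
    refine le_trans (le_of_eq ?_) h5
    ring
  rw [← Nat.cast_one, ← Nat.cast_sub (by omega)] at h4
  exact_mod_cast h4

/-- Reversing a move along a line, `(x, a) ↦ (update x i a, x i)`, is an involution that exchanges
moves out of `U` with moves into it. -/
theorem boundaryCount_compl (U : Finset (Fin n → α)) : boundaryCount Uᶜ = boundaryCount U := by
  have h : ∀ U : Finset (Fin n → α), boundaryCount U =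
      ∑ i, ∑ x, ∑ a, if x ∈ U ∧ Function.update x i a ∉ U then 1 else 0 := fun U => by
    rw [Finset.sum_comm]
    simp only [boundaryCount]
    rw [← Fintype.sum_ite_mem]
    refine Finset.sum_congr rfl fun x _ => ?_
    by_cases hx : x ∈ U
    · simp only [hx, if_true, true_and]
      refine Finset.sum_congr rfl fun i _ => ?_
      rw [← Finset.card_filter, lineCount]
      have := Finset.card_filter_add_card_filter_not (s := Finset.univ)
        fun a => Function.update x i a ∈ U
      rw [Finset.card_univ] at this
      omega
    · simp [hx]
  rw [h, h]
  refine Finset.sum_congr rfl fun i _ => ?_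
  rw [← Fintype.sum_prod_type', ← Fintype.sum_prod_type']
  refine Fintype.sum_equiv
    ⟨fun p => (Function.update p.1 i p.2, p.1 i), fun p => (Function.update p.1 i p.2, p.1 i),
      fun p => by simp, fun p => by simp⟩ _ _ fun p => ?_
  simp [and_comm]

theorem card_add_card_compl (U : Finset (Fin n → α)) :
    U.card + Uᶜ.card = Fintype.card α ^ n := by
  rw [Finset.card_add_card_compl]
  simp

/-- The edge-isoperimetric inequality between the sizes `L ^ t` and `L ^ n - L ^ t`. -/
theorem mul_pow_le_boundaryCount {t : ℕ} (ht : t < n) (hα : 2 ≤ Fintype.card α)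
    {U : Finset (Fin n → α)} (h1 : Fintype.card α ^ t ≤ U.card)
    (h2 : Fintype.card α ^ t ≤ Uᶜ.card) :
    (Fintype.card α - 1) * (n - t) * Fintype.card α ^ t ≤ boundaryCount U := by
  rcases le_total U.card (Fintype.card α ^ (n - 1)) with h3 | h3
  · exact mul_pow_le_boundaryCount_of_le ht hα h1 h3
  rcases le_total Uᶜ.card (Fintype.card α ^ (n - 1)) with h4 | h4
  · rw [← boundaryCount_compl]
    exact mul_pow_le_boundaryCount_of_le ht hα h2 h4
  have h5 := card_add_card_compl U
  refine le_trans ?_ (mul_pow_le_boundaryCount_of_mem_Icc (by omega) hα h3 (by omega))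
  rw [mul_assoc]
  refine Nat.mul_le_mul_left _ ?_
  obtain ⟨d, rfl⟩ : ∃ d, n = t + d + 1 := ⟨n - t - 1, by omega⟩
  rw [Nat.add_sub_cancel, pow_add, mul_comm]
  refine Nat.mul_le_mul_left _ ?_
  have : d < Fintype.card α ^ d := Nat.lt_pow_self hα
  omega

/-- Distinct pairs of a coordinate and a new value give distinct points other than `x`. This trivial
degree bound suffices for sets of at most `L` points. -/
theorem sum_lineCount_sub_one_le (U : Finset (Fin n → α)) {x : Fin n → α} (hx : x ∈ U) :
    ∑ i, (lineCount U i x - 1) ≤ U.card - 1 := by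
  have h : ∀ i, lineCount U i x - 1 =
      (Finset.univ.filter fun a => a ≠ x i ∧ Function.update x i a ∈ U).card := fun i => by
    have : (Finset.univ.filter fun a => a ≠ x i ∧ Function.update x i a ∈ U) =
        (Finset.univ.filter fun a => Function.update x i a ∈ U).erase (x i) := by
      ext a
      simp
    rw [this, Finset.card_erase_of_mem (by simpa using hx), lineCount]
  simp only [h]
  rw [← Finset.card_erase_of_mem hx, ← Finset.card_sigma]
  refine Finset.card_le_card_of_injOn (fun p => Function.update x p.1 p.2) ?_ ?_
  · rintro ⟨i, a⟩ hp
    simp only [Finset.coe_sigma, Set.mem_sigma_iff, Finset.mem_coe, Finset.mem_univ,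
      Finset.mem_filter, true_and] at hp
    simp only [Finset.coe_erase, Set.mem_sdiff, Finset.mem_coe, Set.mem_singleton_iff]
    refine ⟨hp.2, fun e => hp.1 ?_⟩
    rw [← e]
    simp
  · rintro ⟨i, a⟩ hp ⟨j, b⟩ hq e
    simp only [Finset.coe_sigma, Set.mem_sigma_iff, Finset.mem_coe, Finset.mem_univ,
      Finset.mem_filter, true_and] at hp hq e
    obtain rfl : i = j := by
      by_contra hij
      have := congrFun e i
      rw [Function.update_self, Function.update_of_ne hij] at this
      exact hp.1 this
    have := congrFun e i
    simp only [Function.update_self] at this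
    rw [this]

/-- Let `D = (L - 1) n` and `m = |U|`. At most `m - 1` neighbours of a point lie in `U`, so the
boundary is at least `m (D - (m - 1))`, which exceeds `3 (D - 2)` by `(m - 3)(D - m - 2)`. -/
theorem three_mul_le_boundaryCount_of_le (hn : 0 < n) (hα : 4 ≤ Fintype.card α)
    {U : Finset (Fin n → α)} (h1 : 3 ≤ U.card) (h2 : 3 ≤ Uᶜ.card)
    (h3 : U.card ≤ Fintype.card α) :
    3 * ((Fintype.card α - 1) * n - 2) ≤ boundaryCount U := by
  have hs := sum_lineCount_add_boundaryCount U
  have hle : ∑ x ∈ U, ∑ i, (lineCount U i x - 1) ≤ U.card * (U.card - 1) := by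
    rw [← smul_eq_mul, ← Finset.sum_const]
    exact Finset.sum_le_sum fun x hx => sum_lineCount_sub_one_le U hx
  have hc := card_add_card_compl U
  obtain ⟨p, hp⟩ : ∃ p, U.card = p + 3 := ⟨U.card - 3, by omega⟩
  obtain ⟨l, hl⟩ : ∃ l, Fintype.card α = l + 4 := ⟨Fintype.card α - 4, by omega⟩
  obtain ⟨m, rfl⟩ : ∃ m, n = m + 1 := ⟨n - 1, by omega⟩
  rw [hp, hl] at hs hc
  rw [hp] at hle
  rw [hp, hl] at h3
  rw [hl]
  simp only [show l + 4 - 1 = l + 3 by omega, show p + 3 - 1 = p + 2 by omega] at *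
  -- This is `|U| + 2 ≤ (L - 1) n`. In dimension 1 it comes from the three points outside `U`; in
  -- higher dimension from `|U| ≤ L` and `L ≥ 4`.
  have hN : p + 5 ≤ (l + 3) * (m + 1) := by
    rcases m.eq_zero_or_pos with rfl | hm
    · simp only [zero_add, pow_one] at hc
      omega
    · nlinarith
  obtain ⟨q, hq⟩ := Nat.exists_eq_add_of_le hN
  rw [mul_comm (m + 1) (l + 3), hq] at hs
  rw [hq]
  have : p + 5 + q - 2 = p + 3 + q := by omega
  rw [this]
  nlinarith

/-- Once both sides have at least `L` points, the general bound with `t = 1`, namely `(L - 1)(n - 1)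
L`, is already large enough. -/
theorem three_mul_le_boundaryCount (hn : 0 < n) (hα : 4 ≤ Fintype.card α)
    {U : Finset (Fin n → α)} (h1 : 3 ≤ U.card) (h2 : 3 ≤ Uᶜ.card) :
    3 * ((Fintype.card α - 1) * n - 2) ≤ boundaryCount U := by
  rcases le_total U.card (Fintype.card α) with h3 | h3
  · exact three_mul_le_boundaryCount_of_le hn hα h1 h2 h3
  rcases le_total Uᶜ.card (Fintype.card α) with h4 | h4
  · rw [← boundaryCount_compl]
    exact three_mul_le_boundaryCount_of_le hn hα h2 (by rwa [compl_compl]) h4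
  have hc := card_add_card_compl U
  have hn1 : 1 < n := by
    by_contra h
    obtain rfl : n = 1 := by omega
    rw [pow_one] at hc
    omega
  refine le_trans ?_ (mul_pow_le_boundaryCount hn1 (by omega) (by simpa using h3)
    (by simpa using h4))
  obtain ⟨l, hl⟩ : ∃ l, Fintype.card α = l + 4 := ⟨Fintype.card α - 4, by omega⟩
  obtain ⟨m, rfl⟩ : ∃ m, n = m + 2 := ⟨n - 2, by omega⟩
  rw [hl, show l + 4 - 1 = l + 3 by omega, show m + 2 - 1 = m + 1 by omega, pow_one]
  have : (l + 3) * (m + 2) - 2 = l * m + 2 * l + 3 * m + 4 := by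
    rw [Nat.sub_eq_iff_eq_add (by nlinarith)]
    ring
  rw [this]
  nlinarith [mul_nonneg (Nat.zero_le l) (Nat.zero_le m)]

end Isoperimetry

/-! ### Boundaries and connectedness in the Hamming graph; boxes -/

section HammingGraph

variable {L n : ℕ}

theorem hammingGraph_adj_iff {u v : Fin n → Fin L} :
    (hammingGraph L n).Adj u v ↔ ∃ i a, a ≠ u i ∧ Function.update u i a = v := by
  constructor
  · rintro ⟨i, hi, h⟩
    refine ⟨i, v i, Ne.symm hi, funext fun j => ?_⟩
    rcases eq_or_ne j i with rfl | hj
    · simp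
    · rw [Function.update_of_ne hj]
      by_contra hne
      exact hj (h j hne)
  · rintro ⟨i, a, ha, rfl⟩
    refine ⟨i, by simpa using ha.symm, fun j hj => ?_⟩
    by_contra hne
    exact hj (by simp [Function.update_of_ne hne])

theorem hammingGraph_adj_update {u : Fin n → Fin L} {i : Fin n} {a : Fin L} (ha : a ≠ u i) :
    (hammingGraph L n).Adj u (Function.update u i a) :=
  hammingGraph_adj_iff.2 ⟨i, a, ha, rfl⟩

open Classical in
theorem card_filter_hammingGraph_adj (W : Finset (Fin n → Fin L)) (x : Fin n → Fin L) :
    (W.filter ((hammingGraph L n).Adj x)).card =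
      ∑ i, (Finset.univ.filter fun a => a ≠ x i ∧ Function.update x i a ∈ W).card := by
  rw [← Finset.card_sigma]
  symm
  refine Finset.card_bij (fun p _ => Function.update x p.1 p.2) ?_ ?_ ?_
  · rintro ⟨i, a⟩ hp
    simp only [Finset.mem_sigma, Finset.mem_univ, Finset.mem_filter, true_and] at hp ⊢
    exact ⟨hp.2, hammingGraph_adj_update hp.1⟩
  · rintro ⟨i, a⟩ hp ⟨j, b⟩ hq e
    simp only [Finset.mem_sigma, Finset.mem_univ, Finset.mem_filter, true_and] at hp hq e
    obtain rfl : i = j := by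
      by_contra hij
      have := congrFun e i
      rw [Function.update_self, Function.update_of_ne hij] at this
      exact hp.1 this
    have := congrFun e i
    simp only [Function.update_self] at this
    rw [this]
  · intro y hy
    obtain ⟨hyW, hy⟩ := Finset.mem_filter.1 hy
    obtain ⟨i, a, ha, rfl⟩ := hammingGraph_adj_iff.1 hy
    exact ⟨⟨i, a⟩, by simp [ha, hyW], rfl⟩

open Classical in
theorem card_filter_hammingGraph_adj_of_mem {U : Finset (Fin n → Fin L)} {x : Fin n → Fin L}
    (hx : x ∈ U) :
    (U.filter ((hammingGraph L n).Adj x)).card = ∑ i, (lineCount U i x - 1) := by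
  rw [card_filter_hammingGraph_adj]
  refine Finset.sum_congr rfl fun i _ => ?_
  have : (Finset.univ.filter fun a => a ≠ x i ∧ Function.update x i a ∈ U) =
      (Finset.univ.filter fun a => Function.update x i a ∈ U).erase (x i) := by
    ext a
    simp
  rw [this, Finset.card_erase_of_mem (by simpa using hx)]
  simp only [lineCount]

open Classical in
theorem card_filter_compl_hammingGraph_adj {U : Finset (Fin n → Fin L)} {x : Fin n → Fin L}
    (hx : x ∈ U) :
    (Uᶜ.filter ((hammingGraph L n).Adj x)).card = ∑ i, (L - lineCount U i x) := by
  rw [card_filter_hammingGraph_adj]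
  refine Finset.sum_congr rfl fun i _ => ?_
  have h1 : (Finset.univ.filter fun a => a ≠ x i ∧ Function.update x i a ∈ Uᶜ) =
      Finset.univ.filter fun a => ¬ Function.update x i a ∈ U := by
    ext a
    simp only [Finset.mem_filter, Finset.mem_univ, true_and, Finset.mem_compl,
      and_iff_right_iff_imp]
    rintro h rfl
    simp [hx] at h
  have h2 := Finset.card_filter_add_card_filter_not (s := Finset.univ)
    fun a => Function.update x i a ∈ U
  have h3 : lineCount U i x = (Finset.univ.filter fun a => Function.update x i a ∈ U).card := by
    simp only [lineCount]
  rw [Finset.card_univ, Fintype.card_fin] at h2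
  rw [h1, h3]
  omega

/-- A boundary edge has exactly one end in `U`, so orienting it outwards counts it once. -/
theorem ncard_edgesBetween_hammingGraph (U : Finset (Fin n → Fin L)) :
    (edgesBetween (hammingGraph L n) (U : Set (Fin n → Fin L))).ncard = boundaryCount U := by
  classical
  have h : edgesBetween (hammingGraph L n) (U : Set (Fin n → Fin L)) =
      ((U.sigma fun x => Uᶜ.filter ((hammingGraph L n).Adj x)).image
        fun p => s(p.1, p.2) : Finset (Sym2 (Fin n → Fin L))) := by
    ext e
    simp only [edgesBetween, Set.mem_ofPred_eq, Finset.coe_image, Set.mem_image, Finset.mem_coe,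
      Finset.mem_sigma, Finset.mem_filter, Finset.mem_compl]
    constructor
    · rintro ⟨he, u, hu, v, hv, rfl⟩
      exact ⟨⟨u, v⟩, ⟨hu, hv, he⟩, rfl⟩
    · rintro ⟨⟨u, v⟩, ⟨hu, hv, he⟩, rfl⟩
      exact ⟨he, u, hu, v, hv, rfl⟩
  rw [h, Set.ncard_coe_finset, Finset.card_image_of_injOn, Finset.card_sigma]
  · simp only [boundaryCount, Fintype.card_fin]
    exact Finset.sum_congr rfl fun x hx => card_filter_compl_hammingGraph_adj hx
  · rintro ⟨u, v⟩ hp ⟨u', v'⟩ hq e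
    simp only [Finset.coe_sigma, Set.mem_sigma_iff, Finset.mem_coe, Finset.mem_filter,
      Finset.mem_compl] at hp hq
    rcases Sym2.eq_iff.1 e with ⟨h1, h2⟩ | ⟨h1, h2⟩
    · simp only at h1 h2
      rw [h1, h2]
    · simp only at h1 h2
      exact absurd (h2 ▸ hq.1) hp.2.1

/-- A set of strings that stays closed when coordinates are changed to those of a fixed
member induces a connected subgraph. -/
theorem induce_hammingGraph_connected {S : Set (Fin n → Fin L)} {w : Fin n → Fin L} (hw : w ∈ S)
    (h : ∀ v ∈ S, ∀ i, Function.update v i (w i) ∈ S) :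
    ((hammingGraph L n).induce S).Connected := by
  have key : ∀ k : ℕ, ∀ v : S, hammingDist v.1 w = k →
      ((hammingGraph L n).induce S).Reachable v ⟨w, hw⟩ := by
    intro k
    induction k with
    | zero =>
      intro v hv
      have : v = ⟨w, hw⟩ := Subtype.ext (hammingDist_eq_zero.1 hv)
      rw [this]
    | succ k ih =>
      intro v hv
      obtain ⟨i, hi⟩ : ∃ i, v.1 i ≠ w i := by
        by_contra! hne
        rw [funext hne, hammingDist_self] at hv
        omega
      have hadj : ((hammingGraph L n).induce S).Adj v
          ⟨Function.update v.1 i (w i), h v.1 v.2 i⟩ :=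
        hammingGraph_adj_update hi.symm
      refine hadj.reachable.trans (ih _ ?_)
      have herase : (Finset.univ.filter fun j => Function.update v.1 i (w i) j ≠ w j) =
          (Finset.univ.filter fun j => v.1 j ≠ w j).erase i := by
        ext j
        rcases eq_or_ne j i with rfl | hj
        · simp
        · simp [hj]
      simp only [hammingDist] at hv ⊢
      rw [herase, Finset.card_erase_of_mem (by simpa using hi), hv]
      rfl
  have : Nonempty S := ⟨⟨w, hw⟩⟩
  exact ⟨fun u v => (key _ u rfl).trans (key _ v rfl).symm⟩

theorem lineCount_piFinset {A : Fin n → Finset (Fin L)} {x : Fin n → Fin L}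
    (hx : x ∈ Fintype.piFinset A) (i : Fin n) :
    lineCount (Fintype.piFinset A) i x = (A i).card := by
  rw [lineCount]
  congr 1
  ext a
  simp only [Finset.mem_filter, Finset.mem_univ, true_and, Fintype.mem_piFinset] at hx ⊢
  refine ⟨fun h => by simpa using h i, fun h j => ?_⟩
  rcases eq_or_ne j i with rfl | hj
  · simpa using h
  · rw [Function.update_of_ne hj]
    exact hx j

theorem boundaryCount_piFinset (A : Fin n → Finset (Fin L)) :
    boundaryCount (Fintype.piFinset A) = (∏ i, (A i).card) * ∑ i, (L - (A i).card) := by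
  rw [boundaryCount, ← Fintype.card_piFinset, ← smul_eq_mul, ← Finset.sum_const]
  refine Finset.sum_congr rfl fun x hx => ?_
  simp only [Fintype.card_fin, lineCount_piFinset hx]

theorem induce_piFinset_connected (A : Fin n → Finset (Fin L)) (hA : ∀ i, (A i).Nonempty) :
    ((hammingGraph L n).induce
      (Fintype.piFinset A : Set (Fin n → Fin L))).Connected := by
  choose w hw using hA
  refine induce_hammingGraph_connected (w := w) (by simpa using hw) fun v hv i => ?_
  simp only [Finset.mem_coe, Fintype.mem_piFinset] at hv ⊢
  intro j
  rcases eq_or_ne j i with rfl | hj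
  · simpa using hw j
  · simpa [hj] using hv j

/-- The string `w` is a hub outside the box: a coordinate `j` with `v j ∉ A j` keeps `v` outside
while it is unchanged, and since `A j` is then a proper subset, replacing `v j` by `w j` does not
enter `A j` either. -/
theorem induce_compl_piFinset_connected (A : Fin n → Finset (Fin L)) (w : Fin n → Fin L)
    (hw : ∀ i, w i ∈ A i → A i = Finset.univ) (hA : ∃ i, w i ∉ A i) :
    ((hammingGraph L n).induce
      (Fintype.piFinset A : Set (Fin n → Fin L))ᶜ).Connected := by
  refine induce_hammingGraph_connected (w := w) ?_ fun v hv i => ?_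
  · simpa using hA
  · simp only [Set.mem_compl_iff, Finset.mem_coe, Fintype.mem_piFinset, not_forall] at hv ⊢
    obtain ⟨j, hj⟩ := hv
    refine ⟨j, fun h => ?_⟩
    rcases eq_or_ne j i with rfl | hji
    · rw [Function.update_self] at h
      rw [hw j h] at hj
      simp at hj
    · rw [Function.update_of_ne hji] at h
      exact hj h

end HammingGraph

/-! ### Edge-cuts and components in general graphs -/

section Components

variable {V : Type*} {G : SimpleGraph V}

theorem edgesBetween_supp_subset {F : Set (Sym2 V)}
    (c : (G.deleteEdges F).ConnectedComponent) : edgesBetween G c.supp ⊆ F := by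
  rintro e ⟨he, u, hu, v, hv, rfl⟩
  by_contra hF
  exact hv (c.mem_supp_of_adj_mem_supp hu
    ((SimpleGraph.deleteEdges_adj).2 ⟨he, hF⟩))

theorem exists_ne_of_not_connected {H : SimpleGraph V} (hH : ¬ H.Connected)
    (c : H.ConnectedComponent) : ∃ d, d ≠ c := by
  by_contra! h
  have : Nonempty V := c.nonempty_supp.to_type
  refine hH ⟨fun u v => ?_⟩
  rw [← SimpleGraph.ConnectedComponent.eq, h (H.connectedComponentMk u),
    h (H.connectedComponentMk v)]

/-- The cut contains the whole boundary of `c`, and `d` lies in the complement of `c`, so both sides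
of that boundary are large. -/
theorem le_card_of_components [Finite V] {h k : ℕ}
    (hiso : ∀ U : Set V, h ≤ U.ncard → h ≤ Uᶜ.ncard → k ≤ (edgesBetween G U).ncard)
    {F : Finset (Sym2 V)} {c d : (G.deleteEdges (F : Set (Sym2 V))).ConnectedComponent}
    (hcd : c ≠ d) (hc : h ≤ c.supp.ncard) (hd : h ≤ d.supp.ncard) : k ≤ F.card := by
  have hsub : d.supp ⊆ c.suppᶜ := fun v hv hv' => hcd (hv'.symm.trans hv)
  refine (hiso c.supp hc (hd.trans (Set.ncard_le_ncard hsub (Set.toFinite _)))).trans ?_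
  rw [← Set.ncard_coe_finset]
  exact Set.ncard_le_ncard (edgesBetween_supp_subset c) F.finite_toSet

theorem deleteEdges_edgesBetween_adj {X : Set V} {x y : V} :
    (G.deleteEdges (edgesBetween G X)).Adj x y ↔ G.Adj x y ∧ (x ∈ X ↔ y ∈ X) := by
  rw [SimpleGraph.deleteEdges_adj]
  refine and_congr_right fun hxy => ⟨fun h => ?_, ?_⟩
  · by_contra hne
    rw [not_iff] at hne
    by_cases hx : x ∈ X
    · exact h ⟨hxy, x, hx, y, fun hy => hne.2 hy hx, rfl⟩
    · exact h ⟨hxy, y, hne.1 hx, x, hx, Sym2.eq_swap⟩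
  · rintro hiff ⟨-, u, hu, v, hv, e⟩
    rcases Sym2.eq_iff.1 e with ⟨rfl, rfl⟩ | ⟨rfl, rfl⟩
    · exact hv (hiff.1 hu)
    · exact hv (hiff.2 hu)

theorem reachable_deleteEdges_edgesBetween_mem_iff {X : Set V} {x y : V}
    (h : (G.deleteEdges (edgesBetween G X)).Reachable x y) : x ∈ X ↔ y ∈ X := by
  obtain ⟨p⟩ := h
  induction p with
  | nil => exact Iff.rfl
  | cons hadj _ ih => exact (deleteEdges_edgesBetween_adj.1 hadj).2.trans ih

theorem reachable_deleteEdges_of_induce_connected {X S : Set V}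
    (hS : ∀ x ∈ S, ∀ y ∈ S, x ∈ X ↔ y ∈ X) (hconn : (G.induce S).Connected) {x y : V}
    (hx : x ∈ S) (hy : y ∈ S) : (G.deleteEdges (edgesBetween G X)).Reachable x y := by
  let f : G.induce S →g G.deleteEdges (edgesBetween G X) :=
    ⟨Subtype.val, fun {a b} hab => deleteEdges_edgesBetween_adj.2 ⟨hab, hS _ a.2 _ b.2⟩⟩
  exact (hconn.preconnected ⟨x, hx⟩ ⟨y, hy⟩).map f

/-- If both sides of `[X, Xᶜ]` are connected, they are the components left by its removal. -/
theorem supp_eq_or_eq_compl {X : Set V} (hX : (G.induce X).Connected)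
    (hX' : (G.induce Xᶜ).Connected)
    (c : (G.deleteEdges (edgesBetween G X)).ConnectedComponent) :
    c.supp = X ∨ c.supp = Xᶜ := by
  obtain ⟨v, rfl⟩ := c.exists_rep
  change (SimpleGraph.connectedComponentMk _ v).supp = X ∨
    (SimpleGraph.connectedComponentMk _ v).supp = Xᶜ
  by_cases hv : v ∈ X
  · left
    ext w
    rw [SimpleGraph.ConnectedComponent.mem_supp_iff, SimpleGraph.ConnectedComponent.eq]
    exact ⟨fun h => (reachable_deleteEdges_edgesBetween_mem_iff h).2 hv, fun hw =>
      reachable_deleteEdges_of_induce_connected (fun x hx y hy => by simp [hx, hy]) hX hw hv⟩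
  · right
    ext w
    rw [SimpleGraph.ConnectedComponent.mem_supp_iff, SimpleGraph.ConnectedComponent.eq]
    exact ⟨fun h hw => hv ((reachable_deleteEdges_edgesBetween_mem_iff h).1 hw), fun hw =>
      reachable_deleteEdges_of_induce_connected (fun x hx y hy => by simp_all) hX' hw hv⟩

theorem exists_isConditionalEdgeCut [Finite V] {X : Set V} (hX : (G.induce X).Connected)
    (hX' : (G.induce Xᶜ).Connected) {P : ComponentProperty V}
    (hP : ∀ c : (G.deleteEdges (edgesBetween G X)).ConnectedComponent,
      c.supp = X ∨ c.supp = Xᶜ → P _ c) :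
    ∃ F, IsConditionalEdgeCut G P F ∧ F.card = (edgesBetween G X).ncard := by
  have hfin : (edgesBetween G X).Finite := Set.toFinite _
  refine ⟨hfin.toFinset, ?_, (Set.ncard_eq_toFinset_card _ hfin).symm⟩
  rw [IsConditionalEdgeCut, hfin.coe_toFinset]
  refine ⟨fun e he => he.1, fun hconn => ?_, fun c => hP c (supp_eq_or_eq_compl hX hX' c)⟩
  obtain ⟨x, hx⟩ := hX.nonempty
  obtain ⟨y, hy⟩ := hX'.nonempty
  exact hy ((reachable_deleteEdges_edgesBetween_mem_iff (hconn.preconnected x y)).1 hx)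

theorem IsConditionalEdgeCut.mono {P Q : ComponentProperty V} {F : Finset (Sym2 V)}
    (h : IsConditionalEdgeCut G P F)
    (hPQ : ∀ c : (G.deleteEdges (F : Set (Sym2 V))).ConnectedComponent, P _ c → Q _ c) :
    IsConditionalEdgeCut G Q F :=
  ⟨h.1, h.2.1, fun c => hPQ c (h.2.2 c)⟩

theorem IsConditionalEdgeCut.exists_ne {P : ComponentProperty V} {F : Finset (Sym2 V)}
    [Nonempty V] (h : IsConditionalEdgeCut G P F) :
    ∃ c d : (G.deleteEdges (F : Set (Sym2 V))).ConnectedComponent, c ≠ d ∧ P _ c ∧ P _ d := by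
  obtain ⟨d, hd⟩ := exists_ne_of_not_connected h.2.1
    (SimpleGraph.connectedComponentMk _ (Classical.arbitrary V))
  exact ⟨d, _, hd, h.2.2 _, h.2.2 _⟩

/-- If `P` is sandwiched between `Q` and having at least `h` vertices, a `Q`-conditional edge-cut
that attains the isoperimetric bound determines the `P`-conditional edge-connectivity. -/
theorem isConditionalEdgeConnectivity_of_le [Finite V] [Nonempty V] {P Q : ComponentProperty V}
    {h k : ℕ}
    (hiso : ∀ U : Set V, h ≤ U.ncard → h ≤ Uᶜ.ncard → k ≤ (edgesBetween G U).ncard)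
    (hQ : ∃ F, IsConditionalEdgeCut G Q F ∧ F.card = k)
    (hQP : ∀ H ≤ G, ∀ c, Q H c → P H c) (hP : ∀ H ≤ G, ∀ c, P H c → h ≤ c.supp.ncard) :
    IsConditionalEdgeConnectivity G P k := by
  constructor
  · obtain ⟨F, hF, hk⟩ := hQ
    exact ⟨F, hF.mono (hQP _ (SimpleGraph.deleteEdges_le _)), hk⟩
  · rintro m ⟨F, hF, rfl⟩
    obtain ⟨c, d, hcd, hc, hd⟩ := hF.exists_ne
    exact le_card_of_components hiso hcd (hP _ (SimpleGraph.deleteEdges_le _) _ hc)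
      (hP _ (SimpleGraph.deleteEdges_le _) _ hd)

/-- The lower bound uses only two cyclic components, while a cut all of whose components are cyclic
supplies such a pair; hence both notions of cyclic cut have the same minimum. -/
theorem isCyclicEdgeConnectivity_of_le [Finite V] [Nonempty V] {h k : ℕ}
    (hiso : ∀ U : Set V, h ≤ U.ncard → h ≤ Uᶜ.ncard → k ≤ (edgesBetween G U).ncard)
    (hQ : ∃ F, IsConditionalEdgeCut G ContainsCycle F ∧ F.card = k)
    (hP : ∀ H ≤ G, ∀ c, ContainsCycle H c → h ≤ c.supp.ncard) :
    IsCyclicEdgeConnectivity G k := by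
  constructor
  · obtain ⟨F, hF, hk⟩ := hQ
    exact ⟨F, ⟨hF.1, hF.2.1, hF.exists_ne⟩, hk⟩
  · rintro m ⟨F, ⟨-, -, c, d, hcd, hc, hd⟩, rfl⟩
    exact le_card_of_components hiso hcd (hP _ (SimpleGraph.deleteEdges_le _) _ hc)
      (hP _ (SimpleGraph.deleteEdges_le _) _ hd)

variable {H : SimpleGraph V} {c : H.ConnectedComponent}

/-- The vertices of a cycle are distinct. The walk is returned in `H` so that parity of closed walks
can be applied to it. -/
theorem ContainsCycle.exists_length_le [Finite V] (h : ContainsCycle H c) :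
    ∃ (v : V) (p : H.Walk v v), 3 ≤ p.length ∧ p.length ≤ c.supp.ncard := by
  obtain ⟨v, p, hp⟩ := h
  refine ⟨_, p.map c.toSimpleGraph_hom, ?_, ?_⟩
  · simpa using hp.three_le_length
  · have : Fintype c := Fintype.ofFinite c
    have h1 := hp.support_nodup.length_le_card
    rw [List.length_tail, SimpleGraph.Walk.length_support, Nat.add_sub_cancel] at h1
    rw [SimpleGraph.Walk.length_map]
    refine h1.trans (le_of_eq ?_)
    rw [← Nat.card_coe_set_eq, ← Nat.card_eq_fintype_card]
    rfl

theorem ContainsCycle.of_triangle {x y z : V} (hx : x ∈ c.supp) (hxy : H.Adj x y)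
    (hyz : H.Adj y z) (hzx : H.Adj z x) : ContainsCycle H c := by
  have hy := c.mem_supp_of_adj_mem_supp hx hxy
  have hz := c.mem_supp_of_adj_mem_supp hy hyz
  have h1 : c.toSimpleGraph.Adj ⟨x, hx⟩ ⟨y, hy⟩ := hxy
  have h2 : c.toSimpleGraph.Adj ⟨y, hy⟩ ⟨z, hz⟩ := hyz
  have h3 : c.toSimpleGraph.Adj ⟨z, hz⟩ ⟨x, hx⟩ := hzx
  refine ⟨⟨x, hx⟩, .cons h1 (.cons h2 (.cons h3 .nil)), ?_⟩
  have := hxy.ne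
  have := hyz.ne
  have := hzx.ne
  simp [SimpleGraph.Walk.isCycle_def, SimpleGraph.Walk.isTrail_def, *, Ne.symm]

/-- Otherwise the component is a tree with at least two vertices, and it has a leaf. -/
theorem HasMinDegreeAtLeast.containsCycle [Fintype V] {k : ℕ} (hk : 2 ≤ k)
    (h : HasMinDegreeAtLeast k H c) : ContainsCycle H c := by
  classical
  by_contra hc
  have hconn := c.connected_toSimpleGraph
  have htree : c.toSimpleGraph.IsTree := ⟨hconn, fun v p hp => hc ⟨v, p, hp⟩⟩
  obtain ⟨v⟩ := hconn.nonempty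
  have hv : 0 < c.toSimpleGraph.degree v := by
    have := h v
    omega
  obtain ⟨w, hw⟩ := (SimpleGraph.degree_pos_iff_exists_adj _ _).1 hv
  have : Nontrivial c := ⟨v, w, hw.ne⟩
  have h1 := htree.minDegree_eq_one_of_nontrivial
  obtain ⟨u, hu⟩ := c.toSimpleGraph.exists_minimal_degree_vertex
  have := h u
  rw [h1] at hu
  have h3 : c.toSimpleGraph.degree u = 1 := hu.symm
  convert_to k ≤ c.toSimpleGraph.degree u at this
  omega

theorem HasMinDegreeAtLeast.hasAverageDegreeAtLeast [Fintype V] {k : ℕ}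
    (h : HasMinDegreeAtLeast k H c) : HasAverageDegreeAtLeast k H c := by
  classical
  obtain ⟨v⟩ := c.connected_toSimpleGraph.nonempty
  rw [HasAverageDegreeAtLeast, le_div_iff₀ (by exact_mod_cast Fintype.card_pos_iff.2 ⟨v⟩),
    mul_comm, ← nsmul_eq_mul, ← Finset.card_univ, ← Finset.sum_const]
  exact Finset.sum_le_sum fun v _ => by exact_mod_cast h v

open Classical in
theorem degree_toSimpleGraph [Fintype V] (v : c) :
    c.toSimpleGraph.degree v = (Finset.univ.filter fun w => w ∈ c.supp ∧ H.Adj v w).card := by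
  rw [← SimpleGraph.card_neighborFinset_eq_degree, ← Finset.card_map (Function.Embedding.subtype _)]
  congr 1
  ext w
  simp only [Finset.mem_map, SimpleGraph.mem_neighborFinset, Function.Embedding.subtype_apply,
    Finset.mem_filter, Finset.mem_univ, true_and]
  constructor
  · rintro ⟨w, hw, rfl⟩
    exact ⟨w.2, hw⟩
  · rintro ⟨hw, h⟩
    exact ⟨⟨w, hw⟩, h, rfl⟩

theorem CoveredBySubnetworks.mono {𝒮 𝒯 : Set (Set V)} (h𝒮 : 𝒮 ⊆ 𝒯)
    (h : CoveredBySubnetworks G 𝒮 H c) : CoveredBySubnetworks G 𝒯 H c := fun v hv => by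
  obtain ⟨S, hS, h⟩ := h v hv
  exact ⟨S, h𝒮 hS, h⟩

end Components

/-! ### The chain of component properties and the standard sub-layer -/

section HammingConnectivities

variable {L n : ℕ}

theorem leadingSubLayers_subset (L : ℕ) {n t : ℕ} (ht : t ≤ n) :
    leadingSubLayers L n t ⊆ subLayers L n t := by
  rintro S ⟨z, rfl⟩
  refine ⟨Finset.univ.filter fun i : Fin n => (i : ℕ) < t, ?_, z, by simp⟩
  rw [Fin.card_filter_val_lt, min_eq_right ht]

/-- Each of the `t` free coordinates of the sub-layer through a vertex provides `L - 1` neighbours,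
all joined to it by surviving edges. -/
theorem hasMinDegreeAtLeast_of_coveredBySubnetworks {t : ℕ} {H : SimpleGraph (Fin n → Fin L)}
    {c : H.ConnectedComponent}
    (h : CoveredBySubnetworks (hammingGraph L n) (subLayers L n t) H c) :
    HasMinDegreeAtLeast ((L - 1) * t) H c := by
  classical
  intro v
  obtain ⟨S, ⟨I, rfl, z, hS⟩, hvS, hSc, hadj⟩ := h v.1 v.2
  set W : Finset (Fin n → Fin L) := Finset.univ.filter fun u => u ∈ S with hW
  have hcount : (L - 1) * I.card ≤ (W.filter ((hammingGraph L n).Adj v)).card := by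
    rw [card_filter_hammingGraph_adj, mul_comm, ← smul_eq_mul, ← Finset.sum_const]
    refine (Finset.sum_le_sum fun i hi => ?_).trans
      (Finset.sum_le_sum_of_subset (Finset.subset_univ I))
    have : (Finset.univ.erase (v.1 i)) ⊆
        Finset.univ.filter fun a => a ≠ v.1 i ∧ Function.update v.1 i a ∈ W := by
      intro a ha
      simp only [Finset.mem_erase, Finset.mem_univ, and_true] at ha
      simp only [hW, Finset.mem_filter, Finset.mem_univ, true_and]
      refine ⟨ha, ?_⟩
      rw [hS] at hvS ⊢
      intro j hj
      rw [Function.update_of_ne (show j ≠ i by rintro rfl; exact hj hi)]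
      exact hvS j hj
    have := Finset.card_le_card this
    rwa [Finset.card_erase_of_mem (Finset.mem_univ _), Finset.card_univ, Fintype.card_fin] at this
  refine hcount.trans (le_trans ?_ (degree_toSimpleGraph v).ge)
  refine Finset.card_le_card fun w hw => ?_
  simp only [hW, Finset.mem_filter, Finset.mem_univ, true_and] at hw ⊢
  exact ⟨hSc hw.1, hadj _ hvS _ hw.1 hw.2⟩

/-- Degrees in the component are at most those in the Hamming graph induced on its vertex set, to
which the entropy bound applies. -/
theorem pow_le_ncard_of_hasAverageDegreeAtLeast (hL : 2 ≤ L) {t : ℕ}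
    {H : SimpleGraph (Fin n → Fin L)} (hH : H ≤ hammingGraph L n) {c : H.ConnectedComponent}
    (h : HasAverageDegreeAtLeast ((L - 1) * t) H c) : L ^ t ≤ c.supp.ncard := by
  classical
  set U : Finset (Fin n → Fin L) := Finset.univ.filter fun u => u ∈ c.supp with hU
  have hUc : (U : Set (Fin n → Fin L)) = c.supp := by
    ext x
    simp [hU]
  have hne : U.Nonempty := by
    obtain ⟨v, hv⟩ := c.nonempty_supp
    exact ⟨v, by simpa [hU] using hv⟩
  have hcard : Fintype.card c = U.card := by
    rw [← Set.ncard_coe_finset, hUc, ← Nat.card_coe_set_eq, ← Nat.card_eq_fintype_card]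
    rfl
  rw [← hUc, Set.ncard_coe_finset]
  have hpos : (0 : ℚ) < Fintype.card c := by
    rw [hcard]
    exact_mod_cast hne.card_pos
  rw [HasAverageDegreeAtLeast, le_div_iff₀ hpos] at h
  have hle : ∀ v : c, c.toSimpleGraph.degree v ≤ ∑ i, (lineCount U i v.1 - 1) := fun v => by
    have hv : v.1 ∈ U := by
      simp only [hU, Finset.mem_filter, Finset.mem_univ, true_and]
      exact v.2
    rw [← card_filter_hammingGraph_adj_of_mem hv, degree_toSimpleGraph]
    refine Finset.card_le_card fun w hw => ?_
    simp only [hU, Finset.mem_filter, Finset.mem_univ, true_and] at hw ⊢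
    exact ⟨hw.1, hH hw.2⟩
  have hsum : ∑ v : c, c.toSimpleGraph.degree v ≤ ∑ x ∈ U, ∑ i, (lineCount U i x - 1) := by
    refine (Finset.sum_le_sum fun v _ => hle v).trans (le_of_eq ?_)
    symm
    exact Finset.sum_subtype U (p := fun x => x ∈ c) (fun x => by
      rw [hU, Finset.mem_filter]
      exact ⟨fun h => h.2, fun h => ⟨Finset.mem_univ _, h⟩⟩)
      fun x => ∑ i, (lineCount U i x - 1)
  have h' : U.card * ((L - 1) * t) ≤ ∑ v : c, c.toSimpleGraph.degree v := by
    rw [mul_comm, ← hcard]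
    have h2 : (((L - 1) * t : ℕ) : ℚ) * Fintype.card c ≤
        ∑ v : c, (c.toSimpleGraph.degree v : ℚ) := by
      convert h
    exact_mod_cast h2
  have := pow_le_card_of_mul_le_sum (t := t) hne (by simpa using hL)
    (by simpa using h'.trans hsum)
  simpa using this

theorem hammingGraph_isoperimetry {h k : ℕ}
    (hU : ∀ U : Finset (Fin n → Fin L), h ≤ U.card → h ≤ Uᶜ.card → k ≤ boundaryCount U)
    (U : Set (Fin n → Fin L)) (h1 : h ≤ U.ncard) (h2 : h ≤ Uᶜ.ncard) :
    k ≤ (edgesBetween (hammingGraph L n) U).ncard := by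
  classical
  obtain ⟨W, rfl⟩ : ∃ W : Finset (Fin n → Fin L), (W : Set (Fin n → Fin L)) = U :=
    ⟨(Set.toFinite U).toFinset, by simp⟩
  rw [Set.ncard_coe_finset] at h1
  rw [← Finset.coe_compl, Set.ncard_coe_finset] at h2
  rw [ncard_edgesBetween_hammingGraph]
  exact hU W h1 h2

theorem mul_pow_le_ncard_edgesBetween (hL : 2 ≤ L) {t : ℕ} (ht : t < n)
    (U : Set (Fin n → Fin L)) (h1 : L ^ t ≤ U.ncard) (h2 : L ^ t ≤ Uᶜ.ncard) :
    (L - 1) * (n - t) * L ^ t ≤ (edgesBetween (hammingGraph L n) U).ncard :=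
  hammingGraph_isoperimetry (fun U h1 h2 => by
    simpa using mul_pow_le_boundaryCount ht (U := U) (by simpa using hL) (by simpa using h1)
      (by simpa using h2)) U h1 h2

theorem two_mul_pow_le (hL : 2 ≤ L) {t : ℕ} (ht : t < n) : 2 * L ^ t ≤ L ^ n :=
  (Nat.mul_le_mul_right _ hL).trans ((pow_succ' L t).ge.trans (Nat.pow_le_pow_right (by omega) ht))

/-- The sides of a standard sub-layer: the coordinates of index at least `t` are fixed to `0`. -/
def subLayerSides (L n t : ℕ) [NeZero L] (i : Fin n) : Finset (Fin L) :=
  if (i : ℕ) < t then Finset.univ else {0}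

/-- The sub-layer of the strings whose coordinates of index at least `t` vanish. -/
def standardSubLayer (L n t : ℕ) [NeZero L] : Finset (Fin n → Fin L) :=
  Fintype.piFinset (subLayerSides L n t)

variable [NeZero L]

theorem mem_standardSubLayer {t : ℕ} {v : Fin n → Fin L} :
    v ∈ standardSubLayer L n t ↔ ∀ i : Fin n, t ≤ (i : ℕ) → v i = 0 := by
  simp only [standardSubLayer, Fintype.mem_piFinset, subLayerSides]
  refine forall_congr' fun i => ?_
  split_ifs with h
  · simp [h]
  · simp [not_lt.1 h]

theorem prod_card_subLayerSides {t : ℕ} (ht : t ≤ n) :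
    ∏ i, (subLayerSides L n t i).card = L ^ t := by
  have : ∀ i : Fin n, (subLayerSides L n t i).card = if (i : ℕ) < t then L else 1 := fun i => by
    rw [subLayerSides]
    split_ifs <;> simp
  simp only [this]
  rw [Finset.prod_ite, Finset.prod_const, Finset.prod_const_one, mul_one, Fin.card_filter_val_lt,
    min_eq_right ht]

theorem card_standardSubLayer {t : ℕ} (ht : t ≤ n) : (standardSubLayer L n t).card = L ^ t := by
  rw [standardSubLayer, Fintype.card_piFinset, prod_card_subLayerSides ht]

theorem boundaryCount_standardSubLayer {t : ℕ} (ht : t ≤ n) :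
    boundaryCount (standardSubLayer L n t) = (L - 1) * (n - t) * L ^ t := by
  rw [standardSubLayer, boundaryCount_piFinset, prod_card_subLayerSides ht, mul_comm]
  congr 1
  have : ∀ i : Fin n, L - (subLayerSides L n t i).card = if (i : ℕ) < t then 0 else L - 1 :=
    fun i => by
      rw [subLayerSides]
      split_ifs <;> simp
  simp only [this]
  have h := Finset.card_filter_add_card_filter_not (s := Finset.univ) fun i : Fin n => (i : ℕ) < t
  rw [Fin.card_filter_val_lt, min_eq_right ht, Finset.card_univ, Fintype.card_fin] at h
  rw [Finset.sum_ite, Finset.sum_const_zero, zero_add, Finset.sum_const, smul_eq_mul, mul_comm]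
  congr 1
  omega

theorem induce_standardSubLayer_connected (t : ℕ) :
    ((hammingGraph L n).induce (standardSubLayer L n t : Set (Fin n → Fin L))).Connected :=
  induce_piFinset_connected _ fun i => ⟨0, by
    rw [subLayerSides]
    split_ifs <;> simp⟩

theorem induce_compl_standardSubLayer_connected (hL : 2 ≤ L) {t : ℕ} (ht : t < n) :
    ((hammingGraph L n).induce (standardSubLayer L n t : Set (Fin n → Fin L))ᶜ).Connected := by
  have : Nontrivial (Fin L) := Fin.nontrivial_iff_two_le.2 hL
  obtain ⟨a, ha⟩ := exists_ne (0 : Fin L)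
  refine induce_compl_piFinset_connected _ (fun _ => a) (fun i h => ?_) ⟨⟨t, ht⟩, ?_⟩
  · rw [subLayerSides] at h ⊢
    split_ifs at h ⊢
    · rfl
    · simp [ha] at h
  · simp [subLayerSides, ha]

/-- Membership in the standard sub-layer depends only on the coordinates of index at least `t`. So
every leading sub-layer lies on one side of the cut and loses no edge. -/
theorem coveredBySubnetworks_leadingSubLayers {t : ℕ} {H : SimpleGraph (Fin n → Fin L)}
    (hH : H = (hammingGraph L n).deleteEdges
      (edgesBetween (hammingGraph L n) (standardSubLayer L n t : Set (Fin n → Fin L))))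
    {c : H.ConnectedComponent}
    (hc : c.supp = standardSubLayer L n t ∨
      c.supp = (standardSubLayer L n t : Set (Fin n → Fin L))ᶜ) :
    CoveredBySubnetworks (hammingGraph L n) (leadingSubLayers L n t) H c := by
  intro v hv
  have key : ∀ u : Fin n → Fin L, (∀ i : Fin n, t ≤ (i : ℕ) → u i = v i) →
      (u ∈ standardSubLayer L n t ↔ v ∈ standardSubLayer L n t) := fun u hu => by
    simp only [mem_standardSubLayer]
    exact forall_congr' fun i => imp_congr_right fun hi => by rw [hu i hi]
  refine ⟨_, ⟨v, rfl⟩, fun i _ => rfl, fun u hu => ?_, fun x hx y hy hxy => ?_⟩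
  · rcases hc with hc | hc <;> rw [hc] at hv ⊢
    · exact (key u hu).2 hv
    · exact fun h => hv ((key u hu).1 h)
  · rw [hH]
    exact deleteEdges_edgesBetween_adj.2 ⟨hxy, (key x hx).trans (key y hy).symm⟩

theorem exists_isConditionalEdgeCut_leadingSubLayers (hL : 2 ≤ L) {t : ℕ} (ht : t < n) :
    ∃ F, IsConditionalEdgeCut (hammingGraph L n)
      (CoveredBySubnetworks (hammingGraph L n) (leadingSubLayers L n t)) F ∧
      F.card = (L - 1) * (n - t) * L ^ t := by
  rw [← boundaryCount_standardSubLayer ht.le, ← ncard_edgesBetween_hammingGraph]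
  exact exists_isConditionalEdgeCut (induce_standardSubLayer_connected t)
    (induce_compl_standardSubLayer_connected hL ht)
    fun c hc => coveredBySubnetworks_leadingSubLayers rfl hc

theorem le_card_compl_standardSubLayer (hL : 2 ≤ L) {t : ℕ} (ht : t < n) :
    L ^ t ≤ (standardSubLayer L n t)ᶜ.card := by
  have h := card_add_card_compl (standardSubLayer L n t)
  rw [card_standardSubLayer ht.le, Fintype.card_fin] at h
  have := two_mul_pow_le hL ht
  omega

theorem isXi_hammingGraph (hL : 2 ≤ L) {t : ℕ} (ht : t < n) :
    IsXi (hammingGraph L n) (L ^ t) ((L - 1) * (n - t) * L ^ t) := by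
  constructor
  · refine ⟨standardSubLayer L n t, ?_, ?_, induce_standardSubLayer_connected t,
      induce_compl_standardSubLayer_connected hL ht, ?_⟩
    · rw [Set.ncard_coe_finset, card_standardSubLayer ht.le]
    · have := two_mul_pow_le hL ht
      simp only [Nat.card_eq_fintype_card, Fintype.card_pi, Fintype.card_fin, Finset.prod_const,
        Finset.card_univ]
      omega
    · rw [ncard_edgesBetween_hammingGraph, boundaryCount_standardSubLayer ht.le]
  -- The lower bound holds for all sets of this size, whether or not the two sides are connected.
  · rintro _ ⟨X, hX, -, -, -, rfl⟩
    refine mul_pow_le_ncard_edgesBetween hL ht X hX.ge ?_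
    have h := Set.ncard_add_ncard_compl X
    have := two_mul_pow_le hL ht
    simp only [Nat.card_eq_fintype_card, Fintype.card_pi, Fintype.card_fin, Finset.prod_const,
      Finset.card_univ] at h
    omega

theorem isIsoperimetricEdgeConnectivity_hammingGraph (hL : 2 ≤ L) {t : ℕ} (ht : t < n) :
    IsIsoperimetricEdgeConnectivity (hammingGraph L n) (L ^ t) ((L - 1) * (n - t) * L ^ t) := by
  constructor
  · refine ⟨standardSubLayer L n t, ?_, ?_, ?_⟩
    · rw [Set.ncard_coe_finset, card_standardSubLayer ht.le]
    · rw [← Finset.coe_compl, Set.ncard_coe_finset]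
      exact le_card_compl_standardSubLayer hL ht
    · rw [ncard_edgesBetween_hammingGraph, boundaryCount_standardSubLayer ht.le]
  · rintro _ ⟨U, h1, h2, rfl⟩
    exact mul_pow_le_ncard_edgesBetween hL ht U h1 h2

theorem exists_isConditionalEdgeCut_containsCycle (hL : 2 ≤ L) {t : ℕ} (ht : t < n)
    (h : 2 ≤ (L - 1) * t) :
    ∃ F, IsConditionalEdgeCut (hammingGraph L n) ContainsCycle F ∧
      F.card = (L - 1) * (n - t) * L ^ t := by
  obtain ⟨F, hF, hcard⟩ := exists_isConditionalEdgeCut_leadingSubLayers hL ht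
  exact ⟨F, hF.mono fun c hc => (hasMinDegreeAtLeast_of_coveredBySubnetworks
    (hc.mono (leadingSubLayers_subset L ht.le))).containsCycle h, hcard⟩

end HammingConnectivities

/-! ### Cyclic edge-cuts: girth and three collinear points -/

section Cycles

variable {n : ℕ}

/-- The 2-colouring of the hypercube by the parity of the coordinate sum. -/
def parityColoring (n : ℕ) : (hammingGraph 2 n).Coloring Bool :=
  SimpleGraph.Coloring.mk (fun v => decide (∑ i, v i = 0)) fun {u v} huv => by
    obtain ⟨i, a, ha, rfl⟩ := hammingGraph_adj_iff.1 huv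
    rw [Finset.sum_update_of_mem (Finset.mem_univ i),
      ← Finset.add_sum_erase _ _ (Finset.mem_univ i), Finset.sdiff_singleton_eq_erase]
    have key : ∀ a b d : Fin 2, a ≠ d → decide (d + b = 0) ≠ decide (a + b = 0) := by decide
    exact key _ _ _ ha

/-- The parity colouring makes the length of a cycle even, which rules out 3. -/
theorem four_le_ncard_of_containsCycle {H : SimpleGraph (Fin n → Fin 2)}
    (hH : H ≤ hammingGraph 2 n) {c : H.ConnectedComponent} (h : ContainsCycle H c) :
    4 ≤ c.supp.ncard := by
  obtain ⟨v, p, h3, hp⟩ := h.exists_length_le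
  have heven : Even p.length := by
    have := (parityColoring n).even_length_iff_congr (p.mapLe hH)
    rw [SimpleGraph.Walk.length_map] at this
    exact this.2 Iff.rfl
  obtain ⟨k, hk⟩ := heven
  omega

theorem three_le_ncard_of_containsCycle {V : Type*} [Finite V] {H : SimpleGraph V}
    {c : H.ConnectedComponent} (h : ContainsCycle H c) : 3 ≤ c.supp.ncard := by
  obtain ⟨v, p, h3, hp⟩ := h.exists_length_le
  exact h3.trans hp

/-- The sides of a set of three strings that differ in their first coordinate only. -/
def tripleSides (l n : ℕ) (i : Fin n) : Finset (Fin (l + 4)) :=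
  Finset.univ.filter fun a => (a : ℕ) < if i.val = 0 then 3 else 1

/-- Three strings that differ in their first coordinate only. -/
def standardTriple (l n : ℕ) : Finset (Fin n → Fin (l + 4)) :=
  Fintype.piFinset (tripleSides l n)

variable {l : ℕ}

theorem card_tripleSides (i : Fin n) :
    (tripleSides l n i).card = if i.val = 0 then 3 else 1 := by
  rw [tripleSides, Fin.card_filter_val_lt]
  split_ifs <;> omega

theorem boundaryCount_standardTriple :
    boundaryCount (standardTriple l (n + 1)) = 3 * ((l + 3) * (n + 1) - 2) := by
  rw [standardTriple, boundaryCount_piFinset, Fin.prod_univ_succ, Fin.sum_univ_succ]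
  simp only [card_tripleSides, Fin.val_zero, if_true, Fin.val_succ, Nat.succ_ne_zero, if_false,
    Finset.prod_const_one, Finset.sum_const,
    Finset.card_univ, Fintype.card_fin, smul_eq_mul, mul_one]
  congr 1
  rw [show l + 4 - 3 = l + 1 by omega, show l + 4 - 1 = l + 3 by omega,
    show (l + 3) * (n + 1) = n * (l + 3) + l + 3 by ring]
  omega

theorem induce_standardTriple_connected :
    ((hammingGraph (l + 4) n).induce
      (standardTriple l n : Set (Fin n → Fin (l + 4)))).Connected :=
  induce_piFinset_connected _ fun i => ⟨0, by
    simp only [tripleSides, Finset.mem_filter, Finset.mem_univ, true_and]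
    split_ifs <;> simp⟩

theorem notMem_tripleSides {a : Fin (l + 4)} (ha : 3 ≤ (a : ℕ)) (i : Fin n) :
    a ∉ tripleSides l n i := by
  simp only [tripleSides, Finset.mem_filter, Finset.mem_univ, true_and]
  split_ifs <;> omega

/-- The constant string 3 serves as hub, since no side of the box contains 3. -/
theorem induce_compl_standardTriple_connected :
    ((hammingGraph (l + 4) (n + 1)).induce
      (standardTriple l (n + 1) : Set (Fin (n + 1) → Fin (l + 4)))ᶜ).Connected :=
  induce_compl_piFinset_connected _ (fun _ => ⟨3, by omega⟩)
    (fun i h => absurd h (notMem_tripleSides le_rfl i)) ⟨0, notMem_tripleSides le_rfl 0⟩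

/-- Three points on a line in the same part of the vertex set span a cycle. -/
theorem containsCycle_of_line {L : ℕ} {X : Set (Fin n → Fin L)}
    {c : ((hammingGraph L n).deleteEdges
      (edgesBetween (hammingGraph L n) X)).ConnectedComponent}
    (hc : c.supp = X ∨ c.supp = Xᶜ) (z : Fin n → Fin L) (i : Fin n) {a : Fin 3 → Fin L}
    (ha : Function.Injective a) (hz : ∀ k, Function.update z i (a k) ∈ c.supp) :
    ContainsCycle _ c := by
  have hadj : ∀ j k, j ≠ k → ((hammingGraph L n).deleteEdges
      (edgesBetween (hammingGraph L n) X)).Adj (Function.update z i (a j))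
        (Function.update z i (a k)) := fun j k hjk => by
    refine deleteEdges_edgesBetween_adj.2 ⟨?_, ?_⟩
    · have := hammingGraph_adj_update (u := Function.update z i (a j)) (i := i) (a := a k)
        (by simpa using ha.ne hjk.symm)
      simpa using this
    · have hj := hz j
      have hk := hz k
      rcases hc with hc | hc <;> rw [hc] at hj hk
      · exact iff_of_true hj hk
      · exact iff_of_false hj hk
  exact .of_triangle (hz 0) (hadj 0 1 (by decide)) (hadj 1 2 (by decide)) (hadj 2 0 (by decide))

theorem containsCycle_of_supp_eq_standardTriple
    (h : 6 ≤ (l + 4) ^ (n + 1))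
    {c : ((hammingGraph (l + 4) (n + 1)).deleteEdges (edgesBetween (hammingGraph (l + 4) (n + 1))
      (standardTriple l (n + 1) : Set (Fin (n + 1) → Fin (l + 4))))).ConnectedComponent}
    (hc : c.supp = standardTriple l (n + 1) ∨
      c.supp = (standardTriple l (n + 1) : Set (Fin (n + 1) → Fin (l + 4)))ᶜ) :
    ContainsCycle _ c := by
  have hinj : ∀ (d : ℕ) (hd : d + 3 ≤ l + 4),
      Function.Injective fun k : Fin 3 => (⟨d + k, by omega⟩ : Fin (l + 4)) := fun d hd j k e => by
    rw [Fin.mk.injEq] at e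
    exact Fin.ext (by omega)
  have hc₀ := hc
  rcases hc₀ with hc' | hc'
  · refine containsCycle_of_line hc (fun _ => 0) 0 (hinj 0 (by omega)) fun k => ?_
    rw [hc', Finset.mem_coe, standardTriple, Fintype.mem_piFinset]
    intro i
    simp only [tripleSides, Finset.mem_filter, Finset.mem_univ, true_and]
    refine Fin.cases ?_ (fun i => ?_) i
    · simp
    · simp
  -- In dimension 1 the complement contains the values 3, 4, 5, because `6 ≤ L`. In higher dimension
  -- the line whose other coordinates all equal 3 avoids the triple.
  · rcases n.eq_zero_or_pos with rfl | hn
    · refine containsCycle_of_line hc (fun _ => 0) 0 (hinj 3 (by simp at h; omega)) fun k => ?_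
      rw [hc', Set.mem_compl_iff, Finset.mem_coe, standardTriple, Fintype.mem_piFinset]
      intro hk
      refine notMem_tripleSides ?_ _ (hk 0)
      simp
    · refine containsCycle_of_line hc (fun _ => ⟨3, by omega⟩) 0 (hinj 0 (by omega)) fun k => ?_
      rw [hc', Set.mem_compl_iff, Finset.mem_coe, standardTriple, Fintype.mem_piFinset]
      intro hk
      refine notMem_tripleSides ?_ _ (hk (Fin.succ ⟨0, hn⟩))
      simp

theorem exists_isConditionalEdgeCut_containsCycle_triple (h : 6 ≤ (l + 4) ^ (n + 1)) :
    ∃ F, IsConditionalEdgeCut (hammingGraph (l + 4) (n + 1)) ContainsCycle F ∧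
      F.card = 3 * ((l + 3) * (n + 1) - 2) := by
  rw [← boundaryCount_standardTriple, ← ncard_edgesBetween_hammingGraph]
  exact exists_isConditionalEdgeCut induce_standardTriple_connected
    induce_compl_standardTriple_connected fun c hc => containsCycle_of_supp_eq_standardTriple h hc

/-- The cyclic edge-connectivities agree with the isoperimetric bound for the girth of a cycle. -/
theorem cyclicEdgeConnectivity_of_le {V : Type*} [Finite V] [Nonempty V] {G : SimpleGraph V}
    {h k : ℕ}
    (hiso : ∀ U : Set V, h ≤ U.ncard → h ≤ Uᶜ.ncard → k ≤ (edgesBetween G U).ncard)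
    (hQ : ∃ F, IsConditionalEdgeCut G ContainsCycle F ∧ F.card = k)
    (hP : ∀ H ≤ G, ∀ c, ContainsCycle H c → h ≤ c.supp.ncard) :
    IsConditionalEdgeConnectivity G ContainsCycle k ∧ IsCyclicEdgeConnectivity G k :=
  ⟨isConditionalEdgeConnectivity_of_le hiso hQ (fun _ _ _ h => h) hP,
    isCyclicEdgeConnectivity_of_le hiso hQ hP⟩

end Cycles

/-! ### The main theorem -/

theorem mainTheorem4 (L n : ℕ) (hL : 2 ≤ L) :
    (∀ t : ℕ, t < n →
      IsXi (hammingGraph L n) (L ^ t) ((L - 1) * (n - t) * L ^ t) ∧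
      IsConditionalEdgeConnectivity (hammingGraph L n) (HasAtLeastVertices (L ^ t))
        ((L - 1) * (n - t) * L ^ t) ∧
      IsConditionalEdgeConnectivity (hammingGraph L n)
        (CoveredBySubnetworks (hammingGraph L n) (subLayers L n t))
        ((L - 1) * (n - t) * L ^ t) ∧
      IsConditionalEdgeConnectivity (hammingGraph L n)
        (CoveredBySubnetworks (hammingGraph L n) (leadingSubLayers L n t))
        ((L - 1) * (n - t) * L ^ t) ∧
      IsConditionalEdgeConnectivity (hammingGraph L n) (HasMinDegreeAtLeast ((L - 1) * t))
        ((L - 1) * (n - t) * L ^ t) ∧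
      IsConditionalEdgeConnectivity (hammingGraph L n) (HasAverageDegreeAtLeast ((L - 1) * t))
        ((L - 1) * (n - t) * L ^ t) ∧
      IsIsoperimetricEdgeConnectivity (hammingGraph L n) (L ^ t)
        ((L - 1) * (n - t) * L ^ t)) ∧
    (∀ g s : ℕ,
      (L = 2 ∧ g = 1 ∧ s = 2) ∨ (L = 3 ∧ g = 1 ∧ s = 1) ∨ (4 ≤ L ∧ g = 3 ∧ s = 0) →
      g * L ^ s ≤ L ^ n / 2 →
      IsConditionalEdgeConnectivity (hammingGraph L n) ContainsCycle
        (g * ((L - 1) * (n - s) - (g - 1)) * L ^ s) ∧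
      IsCyclicEdgeConnectivity (hammingGraph L n)
        (g * ((L - 1) * (n - s) - (g - 1)) * L ^ s)) := by
  have : NeZero L := ⟨by omega⟩
  constructor
  · intro t ht
    have hiso := mul_pow_le_ncard_edgesBetween hL ht
    have hcut := exists_isConditionalEdgeCut_leadingSubLayers hL ht
    have havg : ∀ H ≤ hammingGraph L n, ∀ c : H.ConnectedComponent,
        HasAverageDegreeAtLeast ((L - 1) * t) H c → L ^ t ≤ c.supp.ncard :=
      fun H hH c => pow_le_ncard_of_hasAverageDegreeAtLeast hL hH
    have hlead : ∀ (H : SimpleGraph (Fin n → Fin L)) (c : H.ConnectedComponent),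
        CoveredBySubnetworks (hammingGraph L n) (leadingSubLayers L n t) H c →
          CoveredBySubnetworks (hammingGraph L n) (subLayers L n t) H c :=
      fun H c h => h.mono (leadingSubLayers_subset L ht.le)
    have hmin : ∀ (H : SimpleGraph (Fin n → Fin L)) (c : H.ConnectedComponent),
        CoveredBySubnetworks (hammingGraph L n) (subLayers L n t) H c →
          HasMinDegreeAtLeast ((L - 1) * t) H c :=
      fun H c h => hasMinDegreeAtLeast_of_coveredBySubnetworks h
    -- All five conditional connectivities use the same cut `hcut` and the same bound `hiso`; only
    -- the position of the property in the chain changes.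
    refine ⟨isXi_hammingGraph hL ht,
      isConditionalEdgeConnectivity_of_le hiso hcut (fun H hH c h => ?_) fun H _ c h => h,
      isConditionalEdgeConnectivity_of_le hiso hcut (fun H _ c h => hlead H c h)
        fun H hH c h => ?_,
      isConditionalEdgeConnectivity_of_le hiso hcut (fun H _ c h => h) fun H hH c h => ?_,
      isConditionalEdgeConnectivity_of_le hiso hcut (fun H _ c h => hmin H c (hlead H c h))
        fun H hH c h => havg H hH c h.hasAverageDegreeAtLeast,
      isConditionalEdgeConnectivity_of_le hiso hcut
        (fun H _ c h => (hmin H c (hlead H c h)).hasAverageDegreeAtLeast) havg,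
      isIsoperimetricEdgeConnectivity_hammingGraph hL ht⟩
    · exact havg H hH c (hmin H c (hlead H c h)).hasAverageDegreeAtLeast
    · exact havg H hH c (hmin H c h).hasAverageDegreeAtLeast
    · exact havg H hH c (hmin H c (hlead H c h)).hasAverageDegreeAtLeast
  · rintro g s (⟨rfl, rfl, rfl⟩ | ⟨rfl, rfl, rfl⟩ | ⟨hL4, rfl, rfl⟩) hn
    · have hn2 : 2 < n := by
        by_contra h
        have : 2 ^ n ≤ 2 ^ 2 := Nat.pow_le_pow_right (by norm_num) (by omega)
        omega
      -- Since `g = 1`, the value is that of the first part for `t = 2`, and `2 ^ 2 = 4` is the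
      -- girth bound.
      simpa using cyclicEdgeConnectivity_of_le (mul_pow_le_ncard_edgesBetween hL hn2)
        (exists_isConditionalEdgeCut_containsCycle hL hn2 (by norm_num))
        fun H hH c h => four_le_ncard_of_containsCycle hH h
    · have hn1 : 1 < n := by
        by_contra h
        have : 3 ^ n ≤ 3 ^ 1 := Nat.pow_le_pow_right (by norm_num) (by omega)
        omega
      simpa using cyclicEdgeConnectivity_of_le (mul_pow_le_ncard_edgesBetween hL hn1)
        (exists_isConditionalEdgeCut_containsCycle hL hn1 (by norm_num))
        fun H hH c h => three_le_ncard_of_containsCycle h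
    · obtain ⟨l, rfl⟩ : ∃ l, L = l + 4 := ⟨L - 4, by omega⟩
      rcases n with _ | n
      · simp at hn
      simp only [pow_zero, mul_one] at hn
      have h6 : 6 ≤ (l + 4) ^ (n + 1) := by omega
      have hiso := hammingGraph_isoperimetry (L := l + 4) (n := n + 1) (h := 3) fun U h1 h2 =>
        three_mul_le_boundaryCount n.succ_pos (by simp) h1 h2
      simp only [Fintype.card_fin] at hiso
      simpa using cyclicEdgeConnectivity_of_le hiso
        (exists_isConditionalEdgeCut_containsCycle_triple h6)
        fun H hH c h => three_le_ncard_of_containsCycle h
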